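/- For real $\sigma,\tau$ put $\varPhi(\sigma,\tau)=(\varphi_1(\sigma,\tau),\varphi_2(\sigma,\tau))$, where, with $e(t)=e^{2\pi i t}$, \[\varphi_1=e(\sigma)+e(\tau)+e(\sigma+\tau)+e(-\sigma)+e(-\tau)+e(-\sigma-\tau),\] \[\varphi_2=e(2\sigma+\tau)+e(\sigma+2\tau)+e(\sigma-\tau)+e(-2\sigma-\tau)+e(-\sigma-2\tau)+e(\tau-\sigma).\] For a positive integer $k$ let $\mathcal{G}_k$, the $k$-th folding polynomial map associated with the Lie algebra $G_2$, be the unique pair of polynomials in $\mathbf{Z}[x,y]$ such that $\mathcal{G}_k(\varPhi(\sigma,\tau))=\varPhi(k\sigma,k\tau)$ for all real $\sigma,\tau$. Let $q$ be a prime power, and let $\bar{\mathcal{G}}_k:\mathbf{F}_q\times\mathbf{F}_q\to\mathbf{F}_q\times\mathbf{F}_q$ be the map that $\mathcal{G}_k$ induces over the field $\mathbf{F}_q$ with $q$ elements. Theorem. Let $k$ be a positive integer and $q$ a prime power. Set \[a=\frac{q-1}{\gcd(q-1,k)},\quad \tilde a=\frac{q+1}{\gcd(q+1,k)},\quad b=\frac{q^2-1}{\gcd(q^2-1,k)},\quad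 c=\frac{q^2+q+1}{\gcd(q^2+q+1,k)},\quad \tilde c=\frac{q^2-q+1}{\gcd(q^2-q+1,k)},\] $a'=\gcd(a,2)$ and $\tilde a'=\gcd(\tilde a,2)$. Then the cardinality of the value set is \[\left|\bar{\mathcal{G}}_k(\mathbf{F}_q\times\mathbf{F}_q)\right|=\frac{a^2}{12}+\frac{\tilde a^2}{12}+\frac b2+\frac c6+\frac{\tilde c}6+\eta(k,q),\] where $\eta(k,q)$ is given as follows. - If ($2\nmid k$ or $2\nmid b$) and ($3\nmid k$ or $3\nmid a\tilde a$), then $\eta(k,q)=0$. - If ($2\nmid k$ or $2\nmid b$), and $3\mid k$ and $3\mid a\tilde a$, then $\eta(k,q)=\frac13$. - If $2\mid k$ and $2\mid b$, and ($3\nmid k$ or $3\nmid a\tilde a$), then $\eta(k,q)=\frac{a+\tilde a}{2}-\frac{1}{2a'\tilde a'}$. - If $2\mid k$ and $2\mid b$ and $3\mid k$ and $3\mid a\tilde a$, then $\eta(k,q)=\frac{a+\tilde a}{2}-\frac{1}{2a'\tilde a'}+\frac13$. In particular, if $\gcd(k,6)=1$, then $\eta(k,q)=0$. -/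

import Mathlib

open MvPolynomial

/-- The exponential `e^{2πit}` of a real number `t`. -/
noncomputable def expTwoPiI (t : ℝ) : ℂ :=
  Complex.exp (2 * (Real.pi : ℂ) * Complex.I * (t : ℂ))

/-- The vector `Φ(σ, τ) = (φ₁(σ, τ), φ₂(σ, τ))` of exponential sums over the orbits, under the
Weyl group of `G₂`, of the two fundamental weights. -/
noncomputable def g2Phi (σ τ : ℝ) : Fin 2 → ℂ :=
  ![expTwoPiI σ + expTwoPiI τ + expTwoPiI (σ + τ)
      + expTwoPiI (-σ) + expTwoPiI (-τ) + expTwoPiI (-(σ + τ)),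
    expTwoPiI (2 * σ + τ) + expTwoPiI (σ + 2 * τ) + expTwoPiI (σ - τ)
      + expTwoPiI (-(2 * σ + τ)) + expTwoPiI (-(σ + 2 * τ)) + expTwoPiI (-(σ - τ))]

/-- The pair `G` of integer polynomials in two variables satisfies `G(Φ(σ, τ)) = Φ(kσ, kτ)`. -/
def IsG2Folding (k : ℕ) (G : Fin 2 → MvPolynomial (Fin 2) ℤ) : Prop :=
  ∀ σ τ : ℝ, (fun i => aeval (g2Phi σ τ) (G i)) = g2Phi (k * σ) (k * τ)

/-- Polynomials expressing the sums of `n`-th powers of the six exponentials in `φ₁`; they serve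
only to prove that the folding polynomials exist. -/
noncomputable def g2Aux : ℕ → MvPolynomial (Fin 2) ℤ
  | 0 => 6
  | 1 => X 0
  | 2 => X 0 ^ 2 - 2 * X 0 - 2 * X 1 - 6
  | 3 => X 0 ^ 3 - 3 * X 0 * X 1 - 9 * X 0 - 6 * X 1 - 12
  | 4 => X 0 * g2Aux 3 - (X 0 + X 1 + 3) * g2Aux 2 + (X 0 ^ 2 - 2 * X 1 - 4) * X 0
      - 4 * (X 0 + X 1 + 3)
  | 5 => X 0 * g2Aux 4 - (X 0 + X 1 + 3) * g2Aux 3 + (X 0 ^ 2 - 2 * X 1 - 4) * g2Aux 2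
      - (X 0 + X 1 + 3) * X 0 + 5 * X 0
  | n + 6 => X 0 * g2Aux (n + 5) - (X 0 + X 1 + 3) * g2Aux (n + 4)
      + (X 0 ^ 2 - 2 * X 1 - 4) * g2Aux (n + 3) - (X 0 + X 1 + 3) * g2Aux (n + 2)
      + X 0 * g2Aux (n + 1) - g2Aux n

theorem aeval_g2Aux {u v a b : ℂ} (hu : u * a = 1) (hv : v * b = 1) (n : ℕ) :
    aeval ![u + v + u * v + a + b + a * b,
        u ^ 2 * v + u * v ^ 2 + u * b + a ^ 2 * b + a * b ^ 2 + a * v] (g2Aux n)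
      = u ^ n + v ^ n + (u * v) ^ n + a ^ n + b ^ n + (a * b) ^ n := by
  have hu0 : u ≠ 0 := left_ne_zero_of_mul_eq_one hu
  have hv0 : v ≠ 0 := left_ne_zero_of_mul_eq_one hv
  obtain rfl : a = u⁻¹ := eq_inv_of_mul_eq_one_right hu
  obtain rfl : b = v⁻¹ := eq_inv_of_mul_eq_one_right hv
  have key : ∀ n, aeval ![u + v + u * v + u⁻¹ + v⁻¹ + u⁻¹ * v⁻¹,
        u ^ 2 * v + u * v ^ 2 + u * v⁻¹ + u⁻¹ ^ 2 * v⁻¹ + u⁻¹ * v⁻¹ ^ 2 + u⁻¹ * v] (g2Aux n)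
      = u ^ n + v ^ n + (u * v) ^ n + u⁻¹ ^ n + v⁻¹ ^ n + (u⁻¹ * v⁻¹) ^ n := by
    intro n
    induction n using g2Aux.induct with
    | case1 => simp [g2Aux]; norm_num
    | case2 => simp [g2Aux]
    | case3 => simp [g2Aux]; field_simp; ring
    | case4 => simp [g2Aux]; field_simp; ring
    | case5 h3 h2 =>
      simp only [g2Aux.eq_5, map_sub, map_add, map_mul, map_pow, h3, h2, aeval_X, map_ofNat]
      simp; field_simp; ring
    | case6 h4 h3 h2 =>
      simp only [g2Aux.eq_6, map_sub, map_add, map_mul, map_pow, h4, h3, h2, aeval_X, map_ofNat]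
      simp; field_simp; ring
    | case7 n h5 h4 h3 h2 h1 h0 =>
      simp only [g2Aux.eq_7, map_sub, map_add, map_mul, map_pow, h5, h4, h3, h2, h1, h0, aeval_X,
        map_ofNat]
      simp only [Matrix.cons_val_zero, Matrix.cons_val_one, Matrix.cons_val_fin_one,
        Nat.succ_eq_add_one, pow_add, mul_pow]
      generalize u ^ n = U
      generalize v ^ n = V
      generalize u⁻¹ ^ n = A
      generalize v⁻¹ ^ n = B
      field_simp
      ring
  exact key n

theorem expTwoPiI_add (s t : ℝ) : expTwoPiI (s + t) = expTwoPiI s * expTwoPiI t := by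
  simp only [expTwoPiI, ← Complex.exp_add]
  push_cast
  ring_nf

theorem expTwoPiI_mul_neg (s : ℝ) : expTwoPiI s * expTwoPiI (-s) = 1 := by
  rw [← expTwoPiI_add]
  simp [expTwoPiI]

theorem expTwoPiI_nat_mul (n : ℕ) (s : ℝ) : expTwoPiI (n * s) = expTwoPiI s ^ n := by
  simp only [expTwoPiI, ← Complex.exp_nat_mul]
  push_cast
  ring_nf

theorem g2Phi_nat_mul (n : ℕ) (σ τ : ℝ) :
    g2Phi (n * σ) (n * τ) =
      let u := expTwoPiI σ ^ n
      let v := expTwoPiI τ ^ n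
      let a := expTwoPiI (-σ) ^ n
      let b := expTwoPiI (-τ) ^ n
      ![u + v + u * v + a + b + a * b,
        u ^ 2 * v + u * v ^ 2 + u * b + a ^ 2 * b + a * b ^ 2 + a * v] := by
  have e1 : -((n : ℝ) * σ + n * τ) = n * -σ + n * -τ := by ring
  have e2 : 2 * ((n : ℝ) * σ) + n * τ = n * σ + n * σ + n * τ := by ring
  have e3 : (n : ℝ) * σ + 2 * (n * τ) = n * σ + (n * τ + n * τ) := by ring
  have e4 : (n : ℝ) * σ - n * τ = n * σ + n * -τ := by ring
  have e5 : -((n : ℝ) * σ + n * σ + n * τ) = n * -σ + n * -σ + n * -τ := by ring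
  have e6 : -((n : ℝ) * σ + (n * τ + n * τ)) = n * -σ + (n * -τ + n * -τ) := by ring
  have e7 : -((n : ℝ) * σ + n * -τ) = n * -σ + n * τ := by ring
  have e8 : -((n : ℝ) * σ) = n * -σ := by ring
  have e9 : -((n : ℝ) * τ) = n * -τ := by ring
  simp only [g2Phi, e1, e2, e3, e4, e5, e6, e7, e8, e9, expTwoPiI_add, expTwoPiI_nat_mul]
  simp only [pow_two]

/-- The folding polynomials exist. -/
theorem exists_isG2Folding (k : ℕ) : ∃ G, IsG2Folding k G := by
  refine ⟨![g2Aux k, bind₁ ![X 1, g2Aux 3] (g2Aux k)], fun σ τ => ?_⟩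
  have h1 := g2Phi_nat_mul 1 σ τ
  have hk := g2Phi_nat_mul k σ τ
  simp only [Nat.cast_one, one_mul, pow_one] at h1
  have hu := expTwoPiI_mul_neg σ
  have hv := expTwoPiI_mul_neg τ
  rw [h1, hk]
  generalize expTwoPiI σ = u at *
  generalize expTwoPiI τ = v at *
  generalize expTwoPiI (-σ) = a at *
  generalize expTwoPiI (-τ) = b at *
  clear h1 hk
  have h2 := aeval_g2Aux hu hv
  -- the exponentials in `φ₂` again form such a system, with `u v²` and `u / v` as generators
  have hu' : (u * v ^ 2) * (a * b ^ 2) = 1 := by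
    linear_combination (v ^ 2 * b ^ 2) * hu + (v * b + 1) * hv
  have hv' : (u * b) * (a * v) = 1 := by linear_combination (v * b) * hu + hv
  have h3 := aeval_g2Aux hu' hv' k
  funext i
  fin_cases i
  · simp only [Fin.zero_eta, Matrix.cons_val_zero, h2 k]
    ring
  · simp only [Fin.mk_one, Matrix.cons_val_one, Matrix.cons_val_fin_one, aeval_bind₁]
    have hb : u * v ^ 2 * (u * b) = u ^ 2 * v := by linear_combination (u ^ 2 * v) * hv
    have ha : a * b ^ 2 * (a * v) = a ^ 2 * b := by linear_combination (a ^ 2 * b) * hv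
    rw [hb, ha] at h3
    have key : (fun i => aeval ![u + v + u * v + a + b + a * b,
        u ^ 2 * v + u * v ^ 2 + u * b + a ^ 2 * b + a * b ^ 2 + a * v]
        ((![X 1, g2Aux 3] : Fin 2 → MvPolynomial (Fin 2) ℤ) i)) =
        ![u * v ^ 2 + u * b + u ^ 2 * v + a * b ^ 2 + a * v + a ^ 2 * b,
          (u * v ^ 2) ^ 2 * (u * b) + (u * v ^ 2) * (u * b) ^ 2 + (u * v ^ 2) * (a * v)
          + (a * b ^ 2) ^ 2 * (a * v) + (a * b ^ 2) * (a * v) ^ 2 + (a * b ^ 2) * (u * b)] := by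
      funext j
      fin_cases j
      · simp; ring
      · simp only [Fin.mk_one, Matrix.cons_val_one, Matrix.cons_val_fin_one, h2 3]
        obtain rfl : a = u⁻¹ := eq_inv_of_mul_eq_one_right hu
        obtain rfl : b = v⁻¹ := eq_inv_of_mul_eq_one_right hv
        have hu0 : u ≠ 0 := left_ne_zero_of_mul_eq_one hu
        have hv0 : v ≠ 0 := left_ne_zero_of_mul_eq_one hv
        field_simp
        ring
    rw [key, h3]
    simp only [mul_pow, ← pow_mul]
    ring

/-- A function that is analytic on the complex plane and vanishes on the real line is zero. -/
theorem eq_zero_of_analytic_of_real {f : ℂ → ℂ} (hf : AnalyticOnNhd ℂ f Set.univ)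
    (h : ∀ t : ℝ, f t = 0) (z : ℂ) : f z = 0 := by
  have hfreq : ∃ᶠ w in nhdsWithin (0 : ℂ) {0}ᶜ, f w = 0 := by
    have ht : Filter.Tendsto (fun t : ℝ => (t : ℂ)) (nhdsWithin 0 {0}ᶜ)
        (nhdsWithin (0 : ℂ) {0}ᶜ) := by
      refine tendsto_nhdsWithin_iff.2 ⟨?_, ?_⟩
      · exact (Complex.continuous_ofReal.tendsto' 0 0 (by simp)).mono_left nhdsWithin_le_nhds
      · filter_upwards [self_mem_nhdsWithin] with t ht
        simpa using ht
    exact ht.frequently (Filter.Frequently.of_forall h)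
  exact hf.eqOn_zero_of_preconnected_of_frequently_eq_zero isPreconnected_univ
    (Set.mem_univ 0) hfreq (Set.mem_univ z)

/-- Every point of `ℂ²` is a value of the complexification of `Φ`. -/
theorem exists_g2_param (x y : ℂ) : ∃ s t : ℂ,
    x = Complex.exp s + Complex.exp t + Complex.exp (s + t)
      + Complex.exp (-s) + Complex.exp (-t) + Complex.exp (-(s + t)) ∧
    y = Complex.exp (2 * s + t) + Complex.exp (s + 2 * t) + Complex.exp (s - t)
      + Complex.exp (-(2 * s + t)) + Complex.exp (-(s + 2 * t)) + Complex.exp (-(s - t)) := by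
  obtain ⟨A, hA⟩ : ∃ A : ℂ, A * (x - A) = y + 3 := by
    obtain ⟨d, hd⟩ := IsAlgClosed.exists_pow_nat_eq (x ^ 2 - 4 * (y + 3)) (n := 2) (by norm_num)
    exact ⟨(x + d) / 2, by linear_combination (-1 / 4) * hd⟩
  -- a root `u` of `T³ - A T² + (x - A) T - 1`, then a root `v` of the quotient by `T - u`
  obtain ⟨u, hu⟩ : ∃ u : ℂ, u ^ 3 - A * u ^ 2 + (x - A) * u - 1 = 0 := by
    let p : Polynomial ℂ := Polynomial.X ^ 3 + (Polynomial.C (-A) * Polynomial.X ^ 2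
      + Polynomial.C (x - A) * Polynomial.X + Polynomial.C (-1))
    have hp : p.degree = 3 := by
      simp only [p]; compute_degree!
    obtain ⟨u, hu⟩ := IsAlgClosed.exists_root p (by rw [hp]; norm_num)
    refine ⟨u, ?_⟩
    simp [p, Polynomial.IsRoot] at hu
    linear_combination hu
  have hu0 : u ≠ 0 := by rintro rfl; simp at hu
  obtain ⟨v, hv⟩ : ∃ v : ℂ, v ^ 2 - (A - u) * v + u⁻¹ = 0 := by
    obtain ⟨d, hd⟩ := IsAlgClosed.exists_pow_nat_eq ((A - u) ^ 2 - 4 * u⁻¹) (n := 2) (by norm_num)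
    exact ⟨(A - u + d) / 2, by linear_combination (1 / 4) * hd⟩
  have hv0 : v ≠ 0 := by rintro rfl; simp [hu0] at hv
  obtain ⟨s, rfl⟩ : ∃ s, Complex.exp s = u := ⟨_, Complex.exp_log hu0⟩
  obtain ⟨t, rfl⟩ : ∃ t, Complex.exp t = v := ⟨_, Complex.exp_log hv0⟩
  have e1 : 2 * s + t = s + s + t := by ring
  have e2 : s + 2 * t = s + (t + t) := by ring
  refine ⟨s, t, ?_⟩
  simp only [e1, e2, sub_eq_add_neg, neg_add, neg_neg, Complex.exp_add, Complex.exp_neg]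
  generalize Complex.exp s = u at *
  generalize Complex.exp t = v at *
  have hA' : A = u + v + (u * v)⁻¹ := by
    field_simp at hv ⊢
    linear_combination -hv
  have hx : x = A + (u⁻¹ + v⁻¹ + u * v) := by
    rw [hA'] at hu ⊢
    field_simp at hu ⊢
    linear_combination hu
  have hy : y = A * (u⁻¹ + v⁻¹ + u * v) - 3 := by
    rw [hx] at hA
    linear_combination -hA
  constructor
  · rw [hx, hA']
    field_simp
    ring
  · rw [hy, hA']
    field_simp
    ring

/-- An integer polynomial that vanishes on all values of `Φ` is zero. -/
theorem eq_zero_of_aeval_g2Phi (P : MvPolynomial (Fin 2) ℤ)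
    (h : ∀ σ τ : ℝ, aeval (g2Phi σ τ) P = 0) : P = 0 := by
  let c : ℂ := 2 * (Real.pi : ℂ) * Complex.I
  have hc : c ≠ 0 := by simp [c, Real.pi_ne_zero]
  let x : ℂ → ℂ → ℂ := fun s t => Complex.exp (c * s) + Complex.exp (c * t)
    + Complex.exp (c * (s + t)) + Complex.exp (c * -s) + Complex.exp (c * -t)
    + Complex.exp (c * -(s + t))
  let y : ℂ → ℂ → ℂ := fun s t => Complex.exp (c * (2 * s + t)) + Complex.exp (c * (s + 2 * t))
    + Complex.exp (c * (s - t)) + Complex.exp (c * -(2 * s + t)) + Complex.exp (c * -(s + 2 * t))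
    + Complex.exp (c * -(s - t))
  have hr : ∀ σ τ : ℝ, aeval ![x σ τ, y σ τ] P = 0 := by
    intro σ τ
    have := h σ τ
    simp only [g2Phi, expTwoPiI] at this
    push_cast at this
    exact this
  have hs : ∀ (s : ℂ) (τ : ℝ), aeval ![x s τ, y s τ] P = 0 := by
    intro s τ
    refine eq_zero_of_analytic_of_real (f := fun s => aeval ![x s τ, y s τ] P) ?_
      (fun σ => hr σ τ) s
    intro z _
    refine AnalyticAt.aeval_mvPolynomial (f := fun s => ![x s τ, y s τ]) ?_ P
    intro i
    fin_cases i
    · change AnalyticAt ℂ (fun s => x s τ) z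
      simp only [x]; fun_prop
    · change AnalyticAt ℂ (fun s => y s τ) z
      simp only [y]; fun_prop
  have ht : ∀ s t : ℂ, aeval ![x s t, y s t] P = 0 := by
    intro s t
    refine eq_zero_of_analytic_of_real (f := fun t => aeval ![x s t, y s t] P) ?_
      (fun τ => hs s τ) t
    intro z _
    refine AnalyticAt.aeval_mvPolynomial (f := fun t => ![x s t, y s t]) ?_ P
    intro i
    fin_cases i
    · change AnalyticAt ℂ (fun t => x s t) z
      simp only [x]; fun_prop
    · change AnalyticAt ℂ (fun t => y s t) z
      simp only [y]; fun_prop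
  have hall : ∀ w : Fin 2 → ℂ, aeval w P = 0 := by
    intro w
    obtain ⟨s, t, h0, h1⟩ := exists_g2_param (w 0) (w 1)
    have hw : w = ![x (s / c) (t / c), y (s / c) (t / c)] := by
      have es : c * (s / c) = s := mul_div_cancel₀ s hc
      have et : c * (t / c) = t := mul_div_cancel₀ t hc
      have k1 : c * (s / c + t / c) = s + t := by rw [mul_add, es, et]
      have k2 : c * (2 * (s / c) + t / c) = 2 * s + t := by
        rw [mul_add, mul_left_comm, es, et]
      have k3 : c * (s / c + 2 * (t / c)) = s + 2 * t := by
        rw [mul_add, mul_left_comm, es, et]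
      have k4 : c * (s / c - t / c) = s - t := by rw [mul_sub, es, et]
      funext i
      fin_cases i
      · simpa [x, mul_neg, -neg_add_rev, -mul_eq_mul_left_iff, es, et, k1] using h0
      · simpa only [Fin.mk_one, Matrix.cons_val_one, Matrix.cons_val_fin_one, y, mul_neg, k2, k3,
          k4] using h1
    rw [hw]
    exact ht _ _
  apply MvPolynomial.map_injective (Int.castRingHom ℂ) Int.cast_injective
  rw [map_zero]
  apply MvPolynomial.funext
  intro w
  rw [eval_map, map_zero]
  exact hall w

/-- The condition `G(Φ(σ, τ)) = Φ(kσ, kτ)` is satisfied by exactly one pair of integer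
polynomials. -/
theorem existsUnique_isG2Folding (k : ℕ) : ∃! G, IsG2Folding k G := by
  obtain ⟨G, hG⟩ := exists_isG2Folding k
  refine ⟨G, hG, fun H hH => ?_⟩
  funext i
  rw [← sub_eq_zero]
  refine eq_zero_of_aeval_g2Phi _ fun σ τ => ?_
  rw [map_sub, sub_eq_zero]
  exact congrFun ((hH σ τ).trans (hG σ τ).symm) i

/-- The folding polynomial map `𝒢_k` associated with the Lie algebra `G₂`: the unique pair of
integer polynomials with `𝒢_k(Φ(σ, τ)) = Φ(kσ, kτ)`. -/
noncomputable def g2Folding (k : ℕ) : Fin 2 → MvPolynomial (Fin 2) ℤ :=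
  (existsUnique_isG2Folding k).choose

theorem g2Folding_spec (k : ℕ) : IsG2Folding k (g2Folding k) :=
  (existsUnique_isG2Folding k).choose_spec.1

/-- The map `F² → F²` induced over `F` by a pair of integer polynomials in two variables. -/
noncomputable def inducedMap (F : Type*) [CommRing F] (G : Fin 2 → MvPolynomial (Fin 2) ℤ)
    (v : Fin 2 → F) : Fin 2 → F :=
  fun i => aeval v (G i)

/-- The quotient `m / gcd(m, k)`; it is exact. -/
def divGcd (m k : ℕ) : ℕ := m / Nat.gcd m k

/-- The correction term `η(k, q)`. -/
def g2Eta (k q : ℕ) : ℚ :=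
  let a := divGcd (q - 1) k
  let a₁ := divGcd (q + 1) k
  let b := divGcd (q ^ 2 - 1) k
  (if 2 ∣ k ∧ 2 ∣ b then
      ((a : ℚ) + a₁) / 2 - 1 / (2 * (Nat.gcd a 2 : ℚ) * (Nat.gcd a₁ 2 : ℚ))
    else 0)
  + (if 3 ∣ k ∧ 3 ∣ a * a₁ then 1 / 3 else 0)

/-! Over an algebraic closure every point of F² is Φ of a torus point (u, v, 1/(uv)), determined up
to the Weyl group W = S₃ × {±1} (permutations and inversion), and 𝒢_k becomes the k-th power map. A
point Φ(p) lies in F² exactly when the q-power Frobenius moves p within its W-orbit. Since w⁶ = 1 in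
W, such p have coordinates in μ_N with N = q⁶ − 1. In logarithms, p is a triple of sum zero in ZMod
N, and the value set corresponds to the W-orbits in U = k·{s | q s ∈ W s} (`multipleSet`,
`image_range_inducedMap`).

An orbit count (`card_mul_ncard_image`) gives 12·|value set| = ∑_w #{s ∈ U | q s = w s}. For w = (σ,
ε) the equation says that Q = εq acts on s as σ. Its solutions form the (Q − 1)-torsion for σ = 1, a
cyclic group of order |Q² − 1| for a transposition and of order |Q² + Q + 1| for a 3-cycle.
Multiplying by k replaces these orders by their `divGcd`, which gives the main terms a², b, c, and
ã², b, c̃ for Q = −q.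

The term η appears because a point of U with q s = w s need not be k times a solution for the same
w. If it comes from another w', then s has a nontrivial stabiliser. This leaves two kinds of excess
points (`signedPermTriple_iff_of_fixId`, `signedPermTriple_iff_of_fixSwap`,
`signedPermTriple_iff_of_fixRot`). For σ = 1 there are points on reflection walls killed by 2a but
not by a; they number 6a, less 3 if a is odd, and occur only when k and b are even. For each 3-cycle
there are the two triples (x, x, x) with x of order 3, when 3 divides k and a. Summing over both
signs and dividing by 12 yields the formula (`sum_ncard_weyl`, `formula_of_twelve_mul`). -/

/-! ### Arithmetic of the quotients m / gcd(m, k) -/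

theorem divGcd_mul_gcd (m k : ℕ) : divGcd m k * Nat.gcd m k = m :=
  Nat.div_mul_cancel (Nat.gcd_dvd_left m k)

theorem dvd_divGcd_mul (m k : ℕ) : m ∣ divGcd m k * k := by
  conv_lhs => rw [← divGcd_mul_gcd m k]
  exact mul_dvd_mul_left _ (Nat.gcd_dvd_right m k)

theorem divGcd_dvd_iff {m : ℕ} (hm : 0 < m) (k n : ℕ) : divGcd m k ∣ n ↔ m ∣ n * k := by
  constructor
  · intro h
    exact (dvd_divGcd_mul m k).trans (mul_dvd_mul_right h k)
  · intro h
    have hg : 0 < Nat.gcd m k := Nat.gcd_pos_of_pos_left k hm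
    have hc : Nat.Coprime (m / Nat.gcd m k) (k / Nat.gcd m k) := Nat.coprime_div_gcd_div_gcd hg
    refine hc.dvd_of_dvd_mul_right ?_
    refine Nat.dvd_of_mul_dvd_mul_right hg ?_
    rw [Nat.div_mul_cancel (Nat.gcd_dvd_left m k), mul_assoc,
      Nat.div_mul_cancel (Nat.gcd_dvd_right m k)]
    exact h

theorem divGcd_dvd (m k : ℕ) : divGcd m k ∣ m := Dvd.intro _ (divGcd_mul_gcd m k)

section Arithmetic

variable {m n k : ℕ}

theorem divGcd_dvd_divGcd_mul_left (hm : 0 < m) : divGcd m k ∣ divGcd (m * n) k :=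
  (divGcd_dvd_iff hm _ _).2 ((Nat.dvd_mul_right m n).trans (dvd_divGcd_mul (m * n) k))

theorem divGcd_mul_dvd (hm : 0 < m) (hn : 0 < n) : divGcd (m * n) k ∣ divGcd m k * n := by
  rw [divGcd_dvd_iff (Nat.mul_pos hm hn), mul_right_comm]
  exact mul_dvd_mul_right (dvd_divGcd_mul m k) n

theorem prime_dvd_divGcd_of_not_dvd {p : ℕ} (hp : p.Prime) (hm : p ∣ m) (hk : ¬ p ∣ k) :
    p ∣ divGcd m k := by
  rw [← divGcd_mul_gcd m k] at hm
  exact (hp.dvd_mul.1 hm).resolve_right fun h => hk (h.trans (Nat.gcd_dvd_right m k))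

theorem sq_dvd_of_dvd_divGcd {p : ℕ} (hk : p ∣ k) (h : p ∣ divGcd m k) : p * p ∣ m := by
  rw [← divGcd_mul_gcd m k]
  exact mul_dvd_mul h (Nat.dvd_gcd (h.trans (divGcd_dvd m k)) hk)

theorem two_mul_divGcd_dvd (hk : 2 ∣ k) (hm : 2 ∣ m) : 2 * divGcd m k ∣ m := by
  conv_rhs => rw [← divGcd_mul_gcd m k]
  rw [mul_comm]
  exact mul_dvd_mul_left _ (Nat.dvd_gcd hm hk)

/-- Let a and b be the quotients for m and m n. If a is odd, evenness of b suffices. If a is even,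
gcd(m, k) already contains the full power of 2 in k, so the 2-part of n passes entirely into b / a.
-/
theorem two_mul_divGcd_dvd_divGcd_mul (hm : 0 < m) (hn : 2 ∣ n)
    (hb : 2 ∣ divGcd (m * n) k) : 2 * divGcd m k ∣ divGcd (m * n) k := by
  obtain ⟨r, hr⟩ := divGcd_dvd_divGcd_mul_left (n := n) (k := k) hm
  rw [hr]
  have ha : 0 < divGcd m k := Nat.pos_of_dvd_of_pos (divGcd_dvd m k) hm
  rw [mul_comm 2]
  refine mul_dvd_mul_left _ ?_
  by_contra hodd
  rw [hr] at hb
  have ha2 : 2 ∣ divGcd m k := (Nat.prime_two.dvd_mul.1 hb).resolve_right hodd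
  set e := Nat.gcd m k with he
  have hepos : 0 < e := Nat.gcd_pos_of_pos_left k hm
  have hme := divGcd_mul_gcd m k
  obtain ⟨l, hl⟩ : e ∣ k := Nat.gcd_dvd_right m k
  have hl2 : ¬ 2 ∣ l := by
    intro h2
    have : 2 * e ∣ e := by
      conv_rhs => rw [he]
      refine Nat.dvd_gcd ?_ ?_
      · rw [← hme]; exact mul_dvd_mul_right ha2 _
      · rw [hl, mul_comm]; exact mul_dvd_mul_left _ h2
    have := Nat.le_of_dvd hepos this
    omega
  have h1 : m * n ∣ divGcd m k * r * k := hr ▸ dvd_divGcd_mul (m * n) k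
  obtain ⟨n', rfl⟩ := hn
  have h2 : 2 ∣ r * l := by
    refine Nat.dvd_of_mul_dvd_mul_left (Nat.mul_pos ha hepos) ?_
    refine Dvd.dvd.trans ⟨n', ?_⟩ (h1.trans (dvd_of_eq ?_))
    · rw [hme]; ring
    · generalize divGcd m k = a
      rw [hl]
      ring
  rcases Nat.prime_two.dvd_mul.1 h2 with h | h
  · exact hodd h
  · exact hl2 h

/-- With a = `divGcd m k`, g divides both a m and a n, hence a·gcd(m, n) and so 2a. The factor 2 is
removed because g also divides a k with k odd, or because g itself is odd. -/
theorem dvd_divGcd_of_dvd {g : ℕ} (hm : 0 < m) (hn : 0 < n) (hmn : Nat.gcd m n ∣ 2)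
    (hgm : g ∣ m) (hgb : g ∣ divGcd (m * n) k) (h : ¬ (2 ∣ k ∧ 2 ∣ divGcd (m * n) k)) :
    g ∣ divGcd m k := by
  have h2 : g ∣ divGcd m k * 2 := by
    have h1 : g ∣ divGcd m k * n := hgb.trans (divGcd_mul_dvd hm hn)
    have h3 : g ∣ divGcd m k * m := hgm.trans (Nat.dvd_mul_left _ _)
    have := Nat.dvd_gcd h3 h1
    rw [Nat.gcd_mul_left] at this
    exact this.trans (mul_dvd_mul_left _ hmn)
  rw [not_and_or] at h
  rcases h with h | h
  · have h3 : g ∣ divGcd m k * k := hgm.trans (dvd_divGcd_mul m k)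
    have := Nat.dvd_gcd h2 h3
    rw [Nat.gcd_mul_left, (Nat.prime_two.coprime_iff_not_dvd.2 h : Nat.gcd 2 k = 1)] at this
    simpa using this
  · have hc : Nat.Coprime g 2 := by
      rw [Nat.coprime_comm, Nat.prime_two.coprime_iff_not_dvd]
      exact fun h' => h (h'.trans hgb)
    exact hc.dvd_of_dvd_mul_right h2

end Arithmetic

/-! ### Torsion in the cyclic group ZMod N -/

section Torsion

variable {N : ℕ} [NeZero N]

theorem ZMod.natCast_mul_eq_zero_of_dvd {N : ℕ} {m n : ℕ} (h : m ∣ n) {x : ZMod N}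
    (hx : (m : ZMod N) * x = 0) : (n : ZMod N) * x = 0 := by
  obtain ⟨e, rfl⟩ := h
  push_cast
  linear_combination (e : ZMod N) * hx

theorem ZMod.natAbs_mul_eq_zero_iff {N : ℕ} {m : ℤ} {x : ZMod N} :
    (m.natAbs : ZMod N) * x = 0 ↔ (m : ZMod N) * x = 0 := by
  rcases Int.natAbs_eq m with h | h
  · conv_rhs => rw [h]
    simp
  · conv_rhs => rw [h]
    simp

theorem ZMod.gcd_mul_eq_zero {N : ℕ} {m n : ℕ} {x : ZMod N}
    (hm : (m : ZMod N) * x = 0) (hn : (n : ZMod N) * x = 0) :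
    ((Nat.gcd m n : ℕ) : ZMod N) * x = 0 := by
  have h := congrArg (Int.cast : ℤ → ZMod N) (Nat.gcd_eq_gcd_ab m n)
  push_cast at h
  rw [h]
  linear_combination (Nat.gcdA m n : ZMod N) * hm + (Nat.gcdB m n : ZMod N) * hn

theorem ZMod.prime_dvd_of_mul_eq_zero {N : ℕ} {p n : ℕ} (hp : p.Prime) {x : ZMod N} (hx : x ≠ 0)
    (hm : (p : ZMod N) * x = 0) (hn : (n : ZMod N) * x = 0) : p ∣ n := by
  by_contra h
  have := ZMod.gcd_mul_eq_zero hm hn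
  rw [(hp.coprime_iff_not_dvd.2 h : Nat.gcd p n = 1)] at this
  exact hx (by simpa using this)

theorem ZMod.ncard_mul_eq_zero {m : ℕ} (hm : m ∣ N) :
    {x : ZMod N | (m : ZMod N) * x = 0}.ncard = m := by
  have h := IsAddCyclic.card_nsmulAddMonoidHom_ker (G := ZMod N) m
  rw [Nat.card_zmod, Nat.gcd_eq_right hm] at h
  conv_rhs => rw [← h]
  rw [← Nat.card_coe_set_eq]
  refine Nat.card_congr (Equiv.subtypeEquivRight fun x => ?_)
  simp [AddMonoidHom.mem_ker]

theorem ZMod.exists_mul_eq_iff {m k : ℕ} (hm : m ∣ N) (x : ZMod N) :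
    (∃ y : ZMod N, (m : ZMod N) * y = 0 ∧ (k : ZMod N) * y = x) ↔
      (divGcd m k : ZMod N) * x = 0 := by
  constructor
  · rintro ⟨y, hy, rfl⟩
    have := ZMod.natCast_mul_eq_zero_of_dvd (dvd_divGcd_mul m k) hy
    push_cast at this
    linear_combination this
  · intro h
    have hmpos : 0 < m := Nat.pos_of_dvd_of_pos hm (NeZero.pos N)
    have ha : 0 < divGcd m k := Nat.pos_of_dvd_of_pos (divGcd_dvd m k) hmpos
    have hme := divGcd_mul_gcd m k
    obtain ⟨l, hl⟩ := hm
    have hx : (x.val : ZMod N) = x := ZMod.natCast_zmod_val x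
    rw [← hx] at h ⊢
    have h' : N ∣ divGcd m k * x.val := by
      rw [← ZMod.natCast_eq_zero_iff]; push_cast; exact h
    replace h' : m * l ∣ divGcd m k * x.val := hl ▸ h'
    obtain ⟨j, hj⟩ : Nat.gcd m k * l ∣ x.val := by
      refine Nat.dvd_of_mul_dvd_mul_left ha ?_
      rwa [← mul_assoc, hme]
    have hN : (m : ZMod N) * l = 0 := by
      have : ((m * l : ℕ) : ZMod N) = 0 := by rw [← hl]; simp
      exact_mod_cast this
    have hg := congrArg (Int.cast : ℤ → ZMod N) (Nat.gcd_eq_gcd_ab m k)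
    push_cast at hg
    -- Bézout: gcd(m, k) = m A + k B, and x = gcd(m, k) l j with m l = N = 0 in ZMod N. Hence k (B l
    -- j) = x.
    refine ⟨(Nat.gcdB m k : ZMod N) * l * j, ?_, ?_⟩
    · linear_combination (Nat.gcdB m k : ZMod N) * j * hN
    · rw [hj]
      push_cast
      rw [hg]
      linear_combination (-(Nat.gcdA m k : ZMod N) * j) * hN

end Torsion

/-! ### Triples of sum zero permuted by multiplication by ±Q -/

section Torus

variable {N : ℕ}

/-- The three residues are killed by `n`. -/
def TorsTriple (n : ℕ) (x y z : ZMod N) : Prop :=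
  (n : ZMod N) * x = 0 ∧ (n : ZMod N) * y = 0 ∧ (n : ZMod N) * z = 0

/-- Multiplication by `Q` fixes the three residues. -/
def FixId (Q : ℤ) (x y z : ZMod N) : Prop :=
  (Q : ZMod N) * x = x ∧ (Q : ZMod N) * y = y ∧ (Q : ZMod N) * z = z

/-- Multiplication by `Q` exchanges the first two residues and fixes the third. -/
def FixSwap (Q : ℤ) (x y z : ZMod N) : Prop :=
  (Q : ZMod N) * x = y ∧ (Q : ZMod N) * y = x ∧ (Q : ZMod N) * z = z

/-- Multiplication by `Q` permutes the three residues cyclically. -/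
def FixRot (Q : ℤ) (x y z : ZMod N) : Prop :=
  (Q : ZMod N) * x = y ∧ (Q : ZMod N) * y = z ∧ (Q : ZMod N) * z = x

/-- The triple is `k` times a triple that multiplication by `Q` permutes. -/
def PermTriple (Q : ℤ) (k : ℕ) (x y z : ZMod N) : Prop :=
  (FixId Q x y z ∧ TorsTriple (divGcd (Q - 1).natAbs k) x y z) ∨
  (FixSwap Q x y z ∧ TorsTriple (divGcd (Q ^ 2 - 1).natAbs k) x y z) ∨
  (FixSwap Q y z x ∧ TorsTriple (divGcd (Q ^ 2 - 1).natAbs k) x y z) ∨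
  (FixSwap Q z x y ∧ TorsTriple (divGcd (Q ^ 2 - 1).natAbs k) x y z) ∨
  (FixRot Q x y z ∧ TorsTriple (divGcd (Q ^ 2 + Q + 1).natAbs k) x y z) ∨
  (FixRot Q x z y ∧ TorsTriple (divGcd (Q ^ 2 + Q + 1).natAbs k) x y z)

/-- For Q = q and sum zero this describes `multipleSet`: the sign in the Weyl group turns q into −q.
-/
def SignedPermTriple (Q : ℤ) (k : ℕ) (x y z : ZMod N) : Prop :=
  PermTriple Q k x y z ∨ PermTriple (-Q) k x y z

theorem signedPermTriple_neg {Q : ℤ} {k : ℕ} {x y z : ZMod N} :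
    SignedPermTriple (-Q) k x y z ↔ SignedPermTriple Q k x y z := by
  rw [SignedPermTriple, SignedPermTriple, neg_neg, or_comm]

theorem TorsTriple.rotate_iff {n : ℕ} {x y z : ZMod N} :
    TorsTriple n y z x ↔ TorsTriple n x y z := by
  simp only [TorsTriple]; tauto

theorem TorsTriple.flip_iff {n : ℕ} {x y z : ZMod N} :
    TorsTriple n x z y ↔ TorsTriple n x y z := by
  simp only [TorsTriple]; tauto

theorem PermTriple.rotate {Q : ℤ} {k : ℕ} {x y z : ZMod N} (h : PermTriple Q k x y z) :
    PermTriple Q k y z x := by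
  rcases h with ⟨⟨h1, h2, h3⟩, t⟩ | ⟨h, t⟩ | ⟨h, t⟩ | ⟨h, t⟩ | ⟨⟨h1, h2, h3⟩, t⟩ | ⟨⟨h1, h2, h3⟩, t⟩
  all_goals rw [← TorsTriple.rotate_iff] at t
  · exact .inl ⟨⟨h2, h3, h1⟩, t⟩
  · exact .inr (.inr (.inr (.inl ⟨h, t⟩)))
  · exact .inr (.inl ⟨h, t⟩)
  · exact .inr (.inr (.inl ⟨h, t⟩))
  · exact .inr (.inr (.inr (.inr (.inl ⟨⟨h2, h3, h1⟩, t⟩))))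
  · exact .inr (.inr (.inr (.inr (.inr ⟨⟨h3, h1, h2⟩, t⟩))))

theorem PermTriple.flip {Q : ℤ} {k : ℕ} {x y z : ZMod N} (h : PermTriple Q k x y z) :
    PermTriple Q k x z y := by
  rcases h with ⟨⟨h1, h2, h3⟩, t⟩ | ⟨⟨h1, h2, h3⟩, t⟩ | ⟨⟨h1, h2, h3⟩, t⟩ | ⟨⟨h1, h2, h3⟩, t⟩ |
    ⟨h, t⟩ | ⟨h, t⟩
  all_goals rw [← TorsTriple.flip_iff] at t
  · exact .inl ⟨⟨h1, h3, h2⟩, t⟩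
  · exact .inr (.inr (.inr (.inl ⟨⟨h2, h1, h3⟩, t⟩)))
  · exact .inr (.inr (.inl ⟨⟨h2, h1, h3⟩, t⟩))
  · exact .inr (.inl ⟨⟨h2, h1, h3⟩, t⟩)
  · exact .inr (.inr (.inr (.inr (.inr ⟨h, t⟩))))
  · exact .inr (.inr (.inr (.inr (.inl ⟨h, t⟩))))

theorem SignedPermTriple.rotate {Q : ℤ} {k : ℕ} {x y z : ZMod N}
    (h : SignedPermTriple Q k x y z) : SignedPermTriple Q k y z x :=
  h.imp PermTriple.rotate PermTriple.rotate

theorem SignedPermTriple.flip {Q : ℤ} {k : ℕ} {x y z : ZMod N}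
    (h : SignedPermTriple Q k x y z) : SignedPermTriple Q k x z y :=
  h.imp PermTriple.flip PermTriple.flip

theorem SignedPermTriple.rotate_iff {Q : ℤ} {k : ℕ} {x y z : ZMod N} :
    SignedPermTriple Q k y z x ↔ SignedPermTriple Q k x y z :=
  ⟨fun h => h.rotate.rotate, fun h => h.rotate⟩

theorem SignedPermTriple.flip_iff {Q : ℤ} {k : ℕ} {x y z : ZMod N} :
    SignedPermTriple Q k x z y ↔ SignedPermTriple Q k x y z :=
  ⟨fun h => h.flip, fun h => h.flip⟩

theorem TorsTriple.of_dvd {m n : ℕ} (h : m ∣ n) {x y z : ZMod N} (ht : TorsTriple m x y z) :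
    TorsTriple n x y z :=
  ⟨ZMod.natCast_mul_eq_zero_of_dvd h ht.1, ZMod.natCast_mul_eq_zero_of_dvd h ht.2.1,
    ZMod.natCast_mul_eq_zero_of_dvd h ht.2.2⟩

theorem torsTriple_zero (n : ℕ) : TorsTriple n (0 : ZMod N) 0 0 := by simp [TorsTriple]

variable {Q : ℤ} {k : ℕ}

/-! ### The primes 2 and 3 in Q − 1, Q² − 1 and Q² + Q + 1 -/

section Moduli

theorem natAbs_sq_sub_one (Q : ℤ) : (Q ^ 2 - 1).natAbs = (Q - 1).natAbs * (Q + 1).natAbs := by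
  rw [← Int.natAbs_mul]; ring_nf

theorem divGcd_sub_one_dvd (k : ℕ) (hQ : 2 ≤ Q.natAbs) :
    divGcd (Q - 1).natAbs k ∣ divGcd (Q ^ 2 - 1).natAbs k := by
  rw [natAbs_sq_sub_one]
  exact divGcd_dvd_divGcd_mul_left (by omega)

theorem mul_eq_zero_of_sub_one_mul_eq_zero {x : ZMod N} (hx : (Q : ZMod N) * x = x) :
    ((Q - 1).natAbs : ZMod N) * x = 0 := by
  rw [ZMod.natAbs_mul_eq_zero_iff]
  push_cast
  linear_combination hx

theorem three_dvd_sub_one_natAbs {x : ZMod N} (hx0 : x ≠ 0) (h3 : 3 * x = 0)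
    (hQx : (Q : ZMod N) * x = x) : 3 ∣ (Q - 1).natAbs :=
  ZMod.prime_dvd_of_mul_eq_zero Nat.prime_three hx0 (by exact_mod_cast h3)
    (mul_eq_zero_of_sub_one_mul_eq_zero hQx)

theorem three_dvd_sq_add_add_one (h : 3 ∣ (Q - 1).natAbs) : 3 ∣ (Q ^ 2 + Q + 1).natAbs := by
  rw [← Int.natCast_dvd] at h ⊢
  obtain ⟨r, hr⟩ := h
  obtain rfl : Q = 3 * r + 1 := by push_cast at hr; omega
  exact ⟨3 * r ^ 2 + 3 * r + 1, by push_cast; ring⟩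

theorem not_nine_dvd_sq_add_add_one (Q : ℤ) : ¬ 3 * 3 ∣ (Q ^ 2 + Q + 1).natAbs := by
  rw [← Int.natCast_dvd]
  intro h
  have h9 : ((Q ^ 2 + Q + 1 : ℤ) : ZMod 9) = 0 := by
    rw [ZMod.intCast_zmod_eq_zero_iff_dvd]; exact_mod_cast h
  push_cast at h9
  generalize (Q : ZMod 9) = r at h9
  revert r
  decide

/-- Q² + Q + 1 contains at most one factor 3, and the gcd removes it when 3 divides k. -/
theorem not_three_dvd_of_three_dvd_divGcd (h : 3 ∣ divGcd (Q ^ 2 + Q + 1).natAbs k) : ¬ 3 ∣ k :=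
  fun hk => not_nine_dvd_sq_add_add_one Q (sq_dvd_of_dvd_divGcd hk h)

/-- When 3 divides Q − 1 it does not divide Q + 1, so the 3-part of Q² − 1 comes from Q − 1 alone.
-/
theorem three_dvd_divGcd_sub_one (hQ : 2 ≤ Q.natAbs) (h : 3 ∣ (Q - 1).natAbs)
    (hb : 3 ∣ divGcd (Q ^ 2 - 1).natAbs k) : 3 ∣ divGcd (Q - 1).natAbs k := by
  rw [natAbs_sq_sub_one] at hb
  have := hb.trans (divGcd_mul_dvd (by omega) (by omega))
  refine (Nat.prime_three.dvd_mul.1 this).resolve_right ?_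
  omega

theorem three_torsion_of_sq_sub_one {x : ZMod N} (hQ : 2 ≤ Q.natAbs) (h3 : 3 * x = 0)
    (hQx : (Q : ZMod N) * x = x) (hb : (divGcd (Q ^ 2 - 1).natAbs k : ZMod N) * x = 0) :
    (divGcd (Q - 1).natAbs k : ZMod N) * x = 0 := by
  by_cases hx0 : x = 0
  · simp [hx0]
  have h := three_dvd_sub_one_natAbs hx0 h3 hQx
  refine ZMod.natCast_mul_eq_zero_of_dvd (three_dvd_divGcd_sub_one hQ h ?_) (by exact_mod_cast h3)
  exact ZMod.prime_dvd_of_mul_eq_zero Nat.prime_three hx0 (by exact_mod_cast h3) hb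

theorem three_torsion_of_sq_add_add_one {x : ZMod N} (h3 : 3 * x = 0)
    (hQx : (Q : ZMod N) * x = x) (hc : (divGcd (Q ^ 2 + Q + 1).natAbs k : ZMod N) * x = 0) :
    (divGcd (Q - 1).natAbs k : ZMod N) * x = 0 := by
  by_cases hx0 : x = 0
  · simp [hx0]
  have h := three_dvd_sub_one_natAbs hx0 h3 hQx
  refine ZMod.natCast_mul_eq_zero_of_dvd (prime_dvd_divGcd_of_not_dvd Nat.prime_three h
    (not_three_dvd_of_three_dvd_divGcd (Q := Q) ?_)) (by exact_mod_cast h3)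
  exact ZMod.prime_dvd_of_mul_eq_zero Nat.prime_three hx0 (by exact_mod_cast h3) hc

/-- For 3 ∤ k the factor 3 of Q² + Q + 1 survives in its quotient. The second alternative is the
source of the 1/3 in η. -/
theorem three_torsion_of_sub_one {x : ZMod N} (h3 : 3 * x = 0)
    (hQx : (Q : ZMod N) * x = x) (ha : (divGcd (Q - 1).natAbs k : ZMod N) * x = 0) :
    (divGcd (Q ^ 2 + Q + 1).natAbs k : ZMod N) * x = 0 ∨
      (3 ∣ k ∧ 3 ∣ divGcd (Q - 1).natAbs k) := by
  by_cases hx0 : x = 0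
  · simp [hx0]
  by_cases hk : 3 ∣ k
  · exact .inr ⟨hk, ZMod.prime_dvd_of_mul_eq_zero Nat.prime_three hx0 (by exact_mod_cast h3) ha⟩
  have h := three_dvd_sub_one_natAbs hx0 h3 hQx
  exact .inl (ZMod.natCast_mul_eq_zero_of_dvd (prime_dvd_divGcd_of_not_dvd Nat.prime_three
    (three_dvd_sq_add_add_one h) hk) (by exact_mod_cast h3))

end Moduli

/-- The triple is fixed by a reflection of the Weyl group. -/
def OnWall (x y z : ZMod N) : Prop := x = y ∨ y = z ∨ z = x ∨ x = 0 ∨ y = 0 ∨ z = 0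

/-- A wall point is fixed by a reflection, so Q acts on it both as the identity and as that
reflection: a transposition for Q when two coordinates agree, a transposition for −Q when one
vanishes. The weaker torsion condition of a transposition is then enough. -/
theorem signedPermTriple_of_onWall {x y z : ZMod N} (h0 : x + y + z = 0) (hw : OnWall x y z) (hf : FixId Q x y z)
    (ht : TorsTriple (divGcd (Q ^ 2 - 1).natAbs k) x y z) : SignedPermTriple Q k x y z := by
  obtain ⟨hx, hy, hz⟩ := hf
  have hb : (-Q) ^ 2 = Q ^ 2 := by ring
  rw [SignedPermTriple, PermTriple, PermTriple, hb]
  rcases hw with rfl | rfl | rfl | rfl | rfl | rfl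
  · exact .inl (.inr (.inl ⟨⟨hx, hx, hz⟩, ht⟩))
  · exact .inl (.inr (.inr (.inl ⟨⟨hy, hy, hx⟩, ht⟩)))
  · exact .inl (.inr (.inr (.inr (.inl ⟨⟨hx, hx, hy⟩, ht⟩))))
  · refine .inr (.inr (.inr (.inl ⟨⟨?_, ?_, by simp⟩, ht⟩)))
    · push_cast; linear_combination -hy - h0
    · push_cast; linear_combination -hz - h0
  · refine .inr (.inr (.inr (.inr (.inl ⟨⟨?_, ?_, by simp⟩, ht⟩))))
    · push_cast; linear_combination -hz - h0
    · push_cast; linear_combination -hx - h0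
  · refine .inr (.inr (.inl ⟨⟨?_, ?_, by simp⟩, ht⟩))
    · push_cast; linear_combination -hx - h0
    · push_cast; linear_combination -hy - h0

/-! ### Points of U on which Q acts as a given permutation -/

section Intersections

variable {x y z : ZMod N}

theorem signedPermTriple_iff_of_fixSwap (hQ : 2 ≤ Q.natAbs) (h0 : x + y + z = 0)
    (hf : FixSwap Q x y z) :
    SignedPermTriple Q k x y z ↔ TorsTriple (divGcd (Q ^ 2 - 1).natAbs k) x y z := by
  refine ⟨?_, fun h => .inl (.inr (.inl ⟨hf, h⟩))⟩
  obtain ⟨hx, hy, hz⟩ := hf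
  have hb : (-Q) ^ 2 = Q ^ 2 := by ring
  have hab := divGcd_sub_one_dvd (Q := -Q) k (by rwa [Int.natAbs_neg])
  have hab' := divGcd_sub_one_dvd (Q := Q) k hQ
  rw [SignedPermTriple, PermTriple, PermTriple]
  rw [hb] at hab ⊢
  rintro ((⟨-, t⟩ | ⟨-, t⟩ | ⟨-, t⟩ | ⟨-, t⟩ | ⟨⟨h1, h2, h3⟩, t⟩ |
    ⟨⟨h1, h2, h3⟩, t⟩) | (⟨-, t⟩ | ⟨-, t⟩ | ⟨-, t⟩ | ⟨-, t⟩ | ⟨⟨h1, h2, h3⟩, t⟩ |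
    ⟨⟨h1, h2, h3⟩, t⟩))
  · exact t.of_dvd hab'
  · exact t
  · exact t
  · exact t
  -- A transposition and a 3-cycle can describe the same action only on a diagonal triple, and sum
  -- zero makes it 3-torsion.
  · obtain rfl : x = z := hy.symm.trans h2
    obtain rfl : x = y := hz.symm.trans hx
    have := three_torsion_of_sq_add_add_one (by linear_combination h0) hz t.1
    exact TorsTriple.of_dvd hab' ⟨this, this, this⟩
  · obtain rfl : y = z := hx.symm.trans h1
    obtain rfl : x = y := hy.symm.trans hz
    have := three_torsion_of_sq_add_add_one (by linear_combination h0) hz t.1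
    exact TorsTriple.of_dvd hab' ⟨this, this, this⟩
  · exact t.of_dvd hab
  · exact t
  · exact t
  · exact t
  all_goals push_cast at h1 h2 h3
  · have y0 : y = 0 := by linear_combination h0 + h2 + hy
    have x0 : x = 0 := by linear_combination -hy + (Q : ZMod N) * y0
    have z0 : z = 0 := by linear_combination -h2 - hy - x0
    subst x0 y0 z0
    exact torsTriple_zero _
  · have x0 : x = 0 := by linear_combination h0 + h1 + hx
    have y0 : y = 0 := by linear_combination -hx + (Q : ZMod N) * x0
    have z0 : z = 0 := by linear_combination -h1 - hx - y0
    subst x0 y0 z0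
    exact torsTriple_zero _

theorem signedPermTriple_iff_of_fixRot (hQ : 2 ≤ Q.natAbs) (h0 : x + y + z = 0)
    (hf : FixRot Q x y z) :
    SignedPermTriple Q k x y z ↔ TorsTriple (divGcd (Q ^ 2 + Q + 1).natAbs k) x y z ∨
      (3 ∣ k ∧ 3 ∣ divGcd (Q - 1).natAbs k ∧ x = y ∧ x = z) := by
  constructor
  swap
  · rintro (h | ⟨hk, ha, rfl, rfl⟩)
    · exact .inl (.inr (.inr (.inr (.inr (.inl ⟨hf, h⟩)))))
    · have := ZMod.natCast_mul_eq_zero_of_dvd ha (x := x) (by push_cast; linear_combination h0)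
      exact .inl (.inl ⟨⟨hf.1, hf.1, hf.1⟩, this, this, this⟩)
  obtain ⟨hx, hy, hz⟩ := hf
  have hb : (-Q) ^ 2 = Q ^ 2 := by ring
  rw [SignedPermTriple, PermTriple, PermTriple]
  rw [hb]
  rintro ((⟨⟨h1, h2, h3⟩, t⟩ | ⟨⟨h1, h2, h3⟩, t⟩ | ⟨⟨h1, h2, h3⟩, t⟩ | ⟨⟨h1, h2, h3⟩, t⟩ | ⟨-, t⟩ |
    ⟨⟨h1, h2, h3⟩, t⟩) | (⟨⟨h1, h2, h3⟩, t⟩ | ⟨⟨h1, h2, h3⟩, t⟩ | ⟨⟨h1, h2, h3⟩, t⟩ |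
    ⟨⟨h1, h2, h3⟩, t⟩ | ⟨⟨h1, h2, h3⟩, t⟩ | ⟨⟨h1, h2, h3⟩, t⟩))
  · obtain rfl : x = y := h1.symm.trans hx
    obtain rfl : x = z := h1.symm.trans hy
    exact (three_torsion_of_sub_one (by linear_combination h0) h1 t.1).imp
      (fun h => ⟨h, h, h⟩) (fun h => ⟨h.1, h.2, rfl, rfl⟩)
  · obtain rfl : x = z := h2.symm.trans hy
    obtain rfl : x = y := h3.symm.trans hx
    exact (three_torsion_of_sub_one (by linear_combination h0) h3 (three_torsion_of_sq_sub_one hQ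
      (by linear_combination h0) h3 t.1)).imp
      (fun h => ⟨h, h, h⟩) (fun h => ⟨h.1, h.2, rfl, rfl⟩)
  · obtain rfl : x = y := h3.symm.trans hx
    obtain rfl : x = z := h3.symm.trans hy
    exact (three_torsion_of_sub_one (by linear_combination h0) h3 (three_torsion_of_sq_sub_one hQ
      (by linear_combination h0) h3 t.1)).imp
      (fun h => ⟨h, h, h⟩) (fun h => ⟨h.1, h.2, rfl, rfl⟩)
  · obtain rfl : y = z := h3.symm.trans hy
    obtain rfl : x = y := hz.symm.trans h3
    exact (three_torsion_of_sub_one (by linear_combination h0) h3 (three_torsion_of_sq_sub_one hQ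
      (by linear_combination h0) h3 t.1)).imp
      (fun h => ⟨h, h, h⟩) (fun h => ⟨h.1, h.2, rfl, rfl⟩)
  · exact .inl t
  · exact .inl t
  all_goals push_cast at h1 h2 h3
  · have z0 : z = 0 := by linear_combination h0 + h1 + hx
    have x0 : x = 0 := by linear_combination -hz + (Q : ZMod N) * z0
    have y0 : y = 0 := by linear_combination -h1 - hx - x0
    subst x0 y0 z0
    exact .inl (torsTriple_zero _)
  · have y0 : y = 0 := by linear_combination h0 + h2 + hy
    have z0 : z = 0 := by linear_combination -hy + (Q : ZMod N) * y0
    have x0 : x = 0 := by linear_combination -h2 - hy - z0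
    subst x0 y0 z0
    exact .inl (torsTriple_zero _)
  · have z0 : z = 0 := by linear_combination h0 + h2 + hz
    have x0 : x = 0 := by linear_combination -hz + (Q : ZMod N) * z0
    have y0 : y = 0 := by linear_combination -h2 - hz - x0
    subst x0 y0 z0
    exact .inl (torsTriple_zero _)
  · have x0 : x = 0 := by linear_combination h0 + h2 + hx
    have y0 : y = 0 := by linear_combination -hx + (Q : ZMod N) * x0
    have z0 : z = 0 := by linear_combination -h2 - hx - y0
    subst x0 y0 z0
    exact .inl (torsTriple_zero _)
  · have x0 : x = 0 := by
      by_contra hne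
      -- Q and −Q rotate the triple in the same way, so 2x = 0; but Q² − Q + 1 = (Q − 1)Q + 1 is
      -- odd.
      have h2c := ZMod.prime_dvd_of_mul_eq_zero Nat.prime_two hne
        (by push_cast; linear_combination -h3 - hz) t.1
      have := h2c.trans (divGcd_dvd _ _)
      rw [← Int.natCast_dvd] at this
      have h' := Int.even_mul_succ_self (Q - 1)
      rw [even_iff_two_dvd] at h'
      have e : Q ^ 2 + -Q + 1 = (Q - 1) * (Q - 1 + 1) + 1 := by ring
      rw [e] at this
      push_cast at this
      omega
    have y0 : y = 0 := by linear_combination -hx + (Q : ZMod N) * x0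
    have z0 : z = 0 := by linear_combination -hy + (Q : ZMod N) * y0
    subst x0 y0 z0
    exact .inl (torsTriple_zero _)
  · have x0 : x = 0 := by linear_combination h0 + h1 + hx
    have y0 : y = 0 := by linear_combination -hx + (Q : ZMod N) * x0
    have z0 : z = 0 := by linear_combination -h1 - hx - y0
    subst x0 y0 z0
    exact .inl (torsTriple_zero _)

end Intersections

variable [NeZero N]

/-! ### Multiples by k of the solutions of Q s = σ s -/

section Multiples

theorem exists_fixId_iff (hm : (Q - 1).natAbs ∣ N) {x y z : ZMod N} (h0 : x + y + z = 0) :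
    (∃ x' y' z' : ZMod N, x' + y' + z' = 0 ∧ FixId Q x' y' z' ∧
      (k : ZMod N) * x' = x ∧ (k : ZMod N) * y' = y ∧ (k : ZMod N) * z' = z) ↔
    FixId Q x y z ∧ TorsTriple (divGcd (Q - 1).natAbs k) x y z := by
  have hfix : ∀ t : ZMod N, ((Q - 1).natAbs : ZMod N) * t = 0 ↔ (Q : ZMod N) * t = t := by
    intro t
    rw [ZMod.natAbs_mul_eq_zero_iff]
    push_cast
    rw [sub_mul, one_mul, sub_eq_zero]
  constructor
  · rintro ⟨x', y', z', h0', ⟨hx, hy, hz⟩, rfl, rfl, rfl⟩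
    refine ⟨⟨?_, ?_, ?_⟩, (ZMod.exists_mul_eq_iff hm _).1 ⟨x', (hfix _).2 hx, rfl⟩,
      (ZMod.exists_mul_eq_iff hm _).1 ⟨y', (hfix _).2 hy, rfl⟩,
      (ZMod.exists_mul_eq_iff hm _).1 ⟨z', (hfix _).2 hz, rfl⟩⟩
    · linear_combination (k : ZMod N) * hx
    · linear_combination (k : ZMod N) * hy
    · linear_combination (k : ZMod N) * hz
  · rintro ⟨-, hx, hy, -⟩
    obtain ⟨x', hx', rfl⟩ := (ZMod.exists_mul_eq_iff hm _).2 hx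
    obtain ⟨y', hy', rfl⟩ := (ZMod.exists_mul_eq_iff hm _).2 hy
    rw [hfix] at hx' hy'
    refine ⟨x', y', -x' - y', by ring, ⟨hx', hy', by linear_combination -hx' - hy'⟩, rfl, rfl, ?_⟩
    linear_combination -h0

/-- The solutions are (x, Qx, −x − Qx) with x in the (Q² − 1)-torsion, so the question reduces to
one cyclic group. -/
theorem exists_fixSwap_iff (hm : (Q ^ 2 - 1).natAbs ∣ N) {x y z : ZMod N} (h0 : x + y + z = 0) :
    (∃ x' y' z' : ZMod N, x' + y' + z' = 0 ∧ FixSwap Q x' y' z' ∧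
      (k : ZMod N) * x' = x ∧ (k : ZMod N) * y' = y ∧ (k : ZMod N) * z' = z) ↔
    FixSwap Q x y z ∧ TorsTriple (divGcd (Q ^ 2 - 1).natAbs k) x y z := by
  constructor
  · rintro ⟨x', y', z', h0', ⟨hx, hy, hz⟩, rfl, rfl, rfl⟩
    have hb : (divGcd (Q ^ 2 - 1).natAbs k : ZMod N) * (k * x') = 0 := by
      refine (ZMod.exists_mul_eq_iff hm _).1 ⟨x', ZMod.natAbs_mul_eq_zero_iff.2 ?_, rfl⟩
      push_cast
      linear_combination (Q : ZMod N) * hx + hy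
    refine ⟨⟨?_, ?_, ?_⟩, hb, ?_, ?_⟩
    · linear_combination (k : ZMod N) * hx
    · linear_combination (k : ZMod N) * hy
    · linear_combination (k : ZMod N) * hz
    · rw [← hx]; linear_combination (Q : ZMod N) * hb
    · generalize (divGcd (Q ^ 2 - 1).natAbs k : ZMod N) = b at *
      linear_combination (-Q - 1 : ZMod N) * hb + b * k * h0' + b * k * hx
  · rintro ⟨⟨hx, hy, hz⟩, hbx, -, -⟩
    obtain ⟨x', hx', rfl⟩ := (ZMod.exists_mul_eq_iff hm _).2 hbx
    rw [ZMod.natAbs_mul_eq_zero_iff] at hx'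
    push_cast at hx'
    refine ⟨x', Q * x', -x' - Q * x', by ring, ⟨rfl, by linear_combination hx',
      by linear_combination -hx'⟩, rfl, by linear_combination hx, ?_⟩
    linear_combination -hx - h0

/-- The solutions are (x, Qx, Q²x) with x in the (Q² + Q + 1)-torsion; sum zero is this torsion
condition. -/
theorem exists_fixRot_iff (hm : (Q ^ 2 + Q + 1).natAbs ∣ N) {x y z : ZMod N}
    (h0 : x + y + z = 0) :
    (∃ x' y' z' : ZMod N, x' + y' + z' = 0 ∧ FixRot Q x' y' z' ∧
      (k : ZMod N) * x' = x ∧ (k : ZMod N) * y' = y ∧ (k : ZMod N) * z' = z) ↔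
    FixRot Q x y z ∧ TorsTriple (divGcd (Q ^ 2 + Q + 1).natAbs k) x y z := by
  constructor
  · rintro ⟨x', y', z', h0', ⟨hx, hy, hz⟩, rfl, rfl, rfl⟩
    have hb : (divGcd (Q ^ 2 + Q + 1).natAbs k : ZMod N) * (k * x') = 0 := by
      refine (ZMod.exists_mul_eq_iff hm _).1 ⟨x', ZMod.natAbs_mul_eq_zero_iff.2 ?_, rfl⟩
      push_cast
      linear_combination (Q + 1 : ZMod N) * hx + hy + h0'
    refine ⟨⟨?_, ?_, ?_⟩, hb, ?_, ?_⟩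
    · linear_combination (k : ZMod N) * hx
    · linear_combination (k : ZMod N) * hy
    · linear_combination (k : ZMod N) * hz
    · rw [← hx]; linear_combination (Q : ZMod N) * hb
    · rw [← hy, ← hx]; linear_combination (Q : ZMod N) ^ 2 * hb
  · rintro ⟨⟨hx, hy, hz⟩, hbx, -, -⟩
    obtain ⟨x', hx', rfl⟩ := (ZMod.exists_mul_eq_iff hm _).2 hbx
    rw [ZMod.natAbs_mul_eq_zero_iff] at hx'
    push_cast at hx'
    refine ⟨x', Q * x', Q ^ 2 * x', by linear_combination hx', ⟨rfl, by ring,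
      by linear_combination (Q - 1 : ZMod N) * hx'⟩, rfl, by linear_combination hx, ?_⟩
    linear_combination hy + (Q : ZMod N) * hx

end Multiples

theorem ZMod.eq_of_two_mul_eq_zero {x y : ZMod N} (hx : 2 * x = 0) (hy : 2 * y = 0) :
    x = 0 ∨ y = 0 ∨ x = y := by
  have key : ∀ t : ZMod N, 2 * t = 0 → t = 0 ∨ 2 * t.val = N := by
    intro t ht
    have h1 : ((2 * t.val : ℕ) : ZMod N) = 0 := by
      push_cast; rw [ZMod.natCast_zmod_val]; exact ht
    rw [ZMod.natCast_eq_zero_iff] at h1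
    obtain ⟨j, hj⟩ := h1
    have := t.val_lt
    rcases j with _ | _ | j
    · left; rw [← ZMod.val_eq_zero]; omega
    · right; omega
    · exfalso
      have : N * (j + 1 + 1) ≥ N * 2 := Nat.mul_le_mul_left _ (by omega)
      omega
  rcases key x hx with h | h
  · exact Or.inl h
  rcases key y hy with h' | h'
  · exact Or.inr (Or.inl h')
  exact Or.inr (Or.inr (ZMod.val_injective N (by omega)))

/-- If Q acts as the identity and also as w, then w fixes the triple. A reflection puts it on a
wall; a rotation forces it to be zero, diagonal 3-torsion, or, for w = −1, 2-torsion. -/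
theorem signedPermTriple_iff_of_fixId {x y z : ZMod N} (hQ : 2 ≤ Q.natAbs) (h0 : x + y + z = 0)
    (hf : FixId Q x y z) :
    SignedPermTriple Q k x y z ↔ TorsTriple (divGcd (Q - 1).natAbs k) x y z ∨
      (TorsTriple (divGcd (Q ^ 2 - 1).natAbs k) x y z ∧ OnWall x y z) := by
  constructor
  swap
  · rintro (h | ⟨h, hw⟩)
    · exact .inl (.inl ⟨hf, h⟩)
    · exact signedPermTriple_of_onWall h0 hw hf h
  obtain ⟨hx, hy, hz⟩ := hf
  have hb : (-Q) ^ 2 = Q ^ 2 := by ring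
  have hab := divGcd_sub_one_dvd (Q := -Q) k (by rwa [Int.natAbs_neg])
  rw [SignedPermTriple, PermTriple, PermTriple]
  rw [hb] at hab ⊢
  rintro ((⟨-, t⟩ | ⟨⟨h1, h2, h3⟩, t⟩ | ⟨⟨h1, h2, h3⟩, t⟩ | ⟨⟨h1, h2, h3⟩, t⟩ | ⟨⟨h1, h2, h3⟩, t⟩ |
    ⟨⟨h1, h2, h3⟩, t⟩) | (⟨⟨h1, h2, h3⟩, t⟩ | ⟨⟨h1, h2, h3⟩, t⟩ | ⟨⟨h1, h2, h3⟩, t⟩ |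
    ⟨⟨h1, h2, h3⟩, t⟩ | ⟨⟨h1, h2, h3⟩, t⟩ | ⟨⟨h1, h2, h3⟩, t⟩))
  · exact .inl t
  · exact .inr ⟨t, .inl (hx.symm.trans h1)⟩
  · exact .inr ⟨t, .inr (.inl (hy.symm.trans h1))⟩
  · exact .inr ⟨t, .inr (.inr (.inl (hz.symm.trans h1)))⟩
  · obtain rfl : x = y := hx.symm.trans h1
    obtain rfl : x = z := hx.symm.trans h2
    have := three_torsion_of_sq_add_add_one (by linear_combination h0) hx t.1
    exact .inl ⟨this, this, this⟩
  · obtain rfl : x = z := hx.symm.trans h1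
    obtain rfl : x = y := hx.symm.trans h2
    have := three_torsion_of_sq_add_add_one (by linear_combination h0) hx t.1
    exact .inl ⟨this, this, this⟩
  -- Here w = −1. A cyclic group has at most one element of order two, so 2-torsion triples also lie
  -- on walls.
  · refine .inr ⟨t.of_dvd hab, ?_⟩
    push_cast at h1 h2
    rcases ZMod.eq_of_two_mul_eq_zero (x := x) (y := y) (by linear_combination -hx - h1)
      (by linear_combination -hy - h2) with h | h | h
    · exact .inr (.inr (.inr (.inl h)))
    · exact .inr (.inr (.inr (.inr (.inl h))))
    · exact .inl h
  all_goals push_cast at h1 h2 h3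
  · refine .inr ⟨t, .inr (.inr (.inr (.inr (.inr ?_))))⟩
    linear_combination h0 + h1 + hx
  · refine .inr ⟨t, .inr (.inr (.inr (.inl ?_)))⟩
    linear_combination h0 + h1 + hy
  · refine .inr ⟨t, .inr (.inr (.inr (.inr (.inl ?_))))⟩
    linear_combination h0 + h1 + hz
  · have x0 : x = 0 := by linear_combination h0 + h2 + hy
    have y0 : y = 0 := by linear_combination h0 + h3 + hz
    have z0 : z = 0 := by linear_combination h0 + h1 + hx
    subst x0 y0 z0
    exact .inl (torsTriple_zero _)
  · have y0 : y = 0 := by linear_combination h0 + h1 + hx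
    have x0 : x = 0 := by linear_combination h0 + h2 + hz
    have z0 : z = 0 := by linear_combination h0 + h3 + hy
    subst x0 y0 z0
    exact .inl (torsTriple_zero _)

end Torus

/-! ### Counting the triples for each permutation -/

section Count

variable {N : ℕ} {Q : ℤ} {k : ℕ}

/-- The number of triples of sum zero with a given property. -/
noncomputable def tripleCount (p : ZMod N → ZMod N → ZMod N → Prop) : ℕ :=
  {v : ZMod N × ZMod N | p v.1 v.2 (-v.1 - v.2)}.ncard

theorem tripleCount_congr {p p' : ZMod N → ZMod N → ZMod N → Prop}
    (h : ∀ x y z, x + y + z = 0 → (p x y z ↔ p' x y z)) : tripleCount p = tripleCount p' := by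
  unfold tripleCount
  congr 1
  ext v
  exact h _ _ _ (by ring)

theorem tripleCount_rotate (p : ZMod N → ZMod N → ZMod N → Prop) :
    tripleCount (fun x y z => p y z x) = tripleCount p := by
  have h : ∀ x y : ZMod N, -y - (-x - y) = x := fun x y => by ring
  refine Set.ncard_congr (fun v _ => (v.2, -v.1 - v.2)) ?_ ?_ ?_
  · rintro ⟨x, y⟩ h'
    simpa [h] using h'
  · rintro ⟨x, y⟩ ⟨x', y'⟩ - - h'
    rw [Prod.mk.injEq] at h'
    obtain ⟨rfl, h'⟩ := h'
    simpa using h'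
  · rintro ⟨x, y⟩ h'
    exact ⟨(-x - y, x), by simpa using h', by simp⟩

theorem tripleCount_flip (p : ZMod N → ZMod N → ZMod N → Prop) :
    tripleCount (fun x y z => p x z y) = tripleCount p := by
  refine Set.ncard_congr (fun v _ => (v.1, -v.1 - v.2)) ?_ ?_ ?_
  · rintro ⟨x, y⟩ h'
    simpa using h'
  · rintro ⟨x, y⟩ ⟨x', y'⟩ - - h'
    rw [Prod.mk.injEq] at h'
    obtain ⟨rfl, h'⟩ := h'
    simpa using h'
  · rintro ⟨x, y⟩ h'
    exact ⟨(x, -x - y), by simpa using h', by simp⟩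

theorem tripleCount_graph (p : ZMod N → Prop) (f : ZMod N → ZMod N) :
    tripleCount (fun x y _ => p x ∧ y = f x) = {x | p x}.ncard := by
  refine Set.ncard_congr (fun v _ => v.1) (fun v h => h.1) ?_ ?_
  · rintro ⟨x, y⟩ ⟨x', y'⟩ ⟨-, h⟩ ⟨-, h'⟩ rfl
    exact Prod.ext rfl (h.trans h'.symm)
  · exact fun x hx => ⟨(x, f x), ⟨hx, rfl⟩, rfl⟩

/-- A triple of sum zero on a wall, killed by `2n`, with last entry but not the others killed
by `n`. -/
def WallPair (n : ℕ) (x y _z : ZMod N) : Prop :=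
  (((2 * n : ℕ) : ZMod N) * x = 0 ∧ (n : ZMod N) * x ≠ 0) ∧ (y = x ∨ y = -x)

theorem WallPair.last_mul_eq_zero {n : ℕ} {x y z : ZMod N} (h0 : x + y + z = 0)
    (h : WallPair n x y z) : (n : ZMod N) * z = 0 := by
  obtain ⟨⟨hx, -⟩, rfl | rfl⟩ := h
  · push_cast at hx; linear_combination (n : ZMod N) * h0 - hx
  · linear_combination (n : ZMod N) * h0

theorem WallPair.mul_ne_zero {n : ℕ} {x y z : ZMod N} (h : WallPair n x y z) :
    (n : ZMod N) * x ≠ 0 ∧ (n : ZMod N) * y ≠ 0 := by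
  obtain ⟨⟨-, hx⟩, rfl | rfl⟩ := h
  · exact ⟨hx, hx⟩
  · exact ⟨hx, by rwa [mul_neg, neg_ne_zero]⟩

theorem WallPair.torsTriple {n : ℕ} {x y z : ZMod N} (h0 : x + y + z = 0)
    (h : WallPair n x y z) : TorsTriple (2 * n) x y z := by
  have hz := ZMod.natCast_mul_eq_zero_of_dvd (Nat.dvd_mul_left n 2) (h.last_mul_eq_zero h0)
  obtain ⟨⟨hx, -⟩, rfl | rfl⟩ := h
  · exact ⟨hx, hx, hz⟩
  · exact ⟨hx, by rw [mul_neg, hx, neg_zero], hz⟩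

theorem WallPair.onWall {n : ℕ} {x y z : ZMod N} (h0 : x + y + z = 0)
    (h : WallPair n x y z) : OnWall x y z := by
  obtain ⟨-, rfl | rfl⟩ := h
  · exact .inl rfl
  · exact .inr (.inr (.inr (.inr (.inr (by linear_combination h0)))))

theorem OnWall.rotate {x y z : ZMod N} (h : OnWall x y z) : OnWall y z x := by
  unfold OnWall at *; tauto

theorem torsTriple_or_wallPair {n : ℕ} {x y z : ZMod N} (h0 : x + y + z = 0)
    (hx : ((2 * n : ℕ) : ZMod N) * x = 0) (hy : y = x ∨ y = -x) :
    TorsTriple n x y z ∨ WallPair n x y z := by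
  by_cases hnx : (n : ZMod N) * x = 0
  · left
    have hny : (n : ZMod N) * y = 0 := by
      rcases hy with rfl | rfl
      · exact hnx
      · rw [mul_neg, hnx, neg_zero]
    exact ⟨hnx, hny, by linear_combination (n : ZMod N) * h0 - hnx - hny⟩
  · exact .inr ⟨⟨hx, hnx⟩, hy⟩

/-- As the sum is zero, z = 0 means y = −x. The six walls thus group into three pairs, one for each
choice of last coordinate. -/
theorem torsTriple_or_wallPairs {n : ℕ} {x y z : ZMod N} (h0 : x + y + z = 0)
    (ht : TorsTriple (2 * n) x y z) (hw : OnWall x y z) :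
    TorsTriple n x y z ∨ WallPair n x y z ∨ WallPair n y z x ∨ WallPair n z x y := by
  have h0' : y + z + x = 0 := by linear_combination h0
  have h0'' : z + x + y = 0 := by linear_combination h0
  have a1 := torsTriple_or_wallPair h0 ht.1
  have a2 := torsTriple_or_wallPair h0' ht.2.1
  have a3 := torsTriple_or_wallPair h0'' ht.2.2
  rw [TorsTriple.rotate_iff] at a2
  rw [TorsTriple.rotate_iff, TorsTriple.rotate_iff] at a3
  rcases hw with h | h | h | h | h | h
  · exact (a1 (.inl h.symm)).imp id .inl
  · exact (a2 (.inl h.symm)).imp id fun h => .inr (.inl h)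
  · exact (a3 (.inl h.symm)).imp id fun h => .inr (.inr h)
  · exact (a2 (.inr (by linear_combination h0 - h))).imp id fun h => .inr (.inl h)
  · exact (a3 (.inr (by linear_combination h0 - h))).imp id fun h => .inr (.inr h)
  · exact (a1 (.inr (by linear_combination h0 - h))).imp id .inl

theorem fixed_of_dvd {n : ℕ} (hn : n ∣ (Q - 1).natAbs) {x : ZMod N} (hx : (n : ZMod N) * x = 0) :
    (Q : ZMod N) * x = x := by
  have := ZMod.natCast_mul_eq_zero_of_dvd hn hx
  rw [ZMod.natAbs_mul_eq_zero_iff] at this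
  push_cast at this
  linear_combination this

theorem TorsTriple.fixId {n : ℕ} (hn : n ∣ (Q - 1).natAbs) {x y z : ZMod N}
    (h : TorsTriple n x y z) : FixId Q x y z :=
  ⟨fixed_of_dvd hn h.1, fixed_of_dvd hn h.2.1, fixed_of_dvd hn h.2.2⟩

theorem gcd_natAbs_dvd_two (Q : ℤ) : Nat.gcd (Q - 1).natAbs (Q + 1).natAbs ∣ 2 := by
  have h := dvd_sub (Int.gcd_dvd_right (Q - 1) (Q + 1)) (Int.gcd_dvd_left (Q - 1) (Q + 1))
  have e : Q + 1 - (Q - 1) = 2 := by ring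
  rw [e] at h
  exact Int.natCast_dvd.1 h

/-- The condition under which the factor two contributes to the correction term. -/
def TwoCond (Q : ℤ) (k : ℕ) : Prop := 2 ∣ k ∧ 2 ∣ divGcd (Q ^ 2 - 1).natAbs k

instance (Q : ℤ) (k : ℕ) : Decidable (TwoCond Q k) := inferInstanceAs (Decidable (_ ∧ _))

/-- The quotient for Q² − 1 divides the one for Q − 1 times Q + 1, and Q + 1 acts as 2 on a fixed x.
-/
theorem torsion_two_mul (hQ : 2 ≤ Q.natAbs) {x : ZMod N} (hx : (Q : ZMod N) * x = x)
    (hb : (divGcd (Q ^ 2 - 1).natAbs k : ZMod N) * x = 0) :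
    ((2 * divGcd (Q - 1).natAbs k : ℕ) : ZMod N) * x = 0 := by
  rw [natAbs_sq_sub_one] at hb
  have h := ZMod.natCast_mul_eq_zero_of_dvd (divGcd_mul_dvd (by omega) (by omega)) hb
  push_cast at h ⊢
  generalize (divGcd (Q - 1).natAbs k : ZMod N) = a at *
  have h' : a * (Q + 1) * x = 0 := by
    have : ((Q + 1).natAbs : ZMod N) * (a * x) = 0 := by linear_combination h
    rw [ZMod.natAbs_mul_eq_zero_iff] at this
    push_cast at this
    linear_combination this
  linear_combination h' - a * hx

theorem torsion_of_not_twoCond (hQ : 2 ≤ Q.natAbs) (hP : ¬ TwoCond Q k) {x : ZMod N}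
    (hx : (Q : ZMod N) * x = x) (hb : (divGcd (Q ^ 2 - 1).natAbs k : ZMod N) * x = 0) :
    (divGcd (Q - 1).natAbs k : ZMod N) * x = 0 := by
  have h := ZMod.gcd_mul_eq_zero (mul_eq_zero_of_sub_one_mul_eq_zero hx) hb
  refine ZMod.natCast_mul_eq_zero_of_dvd ?_ h
  rw [TwoCond] at hP
  rw [natAbs_sq_sub_one] at hP ⊢
  exact dvd_divGcd_of_dvd (by omega) (by omega) (gcd_natAbs_dvd_two Q) (Nat.gcd_dvd_left _ _)
    (Nat.gcd_dvd_right _ _) hP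

theorem odd_of_twoCond (hP : TwoCond Q k) : 2 ∣ (Q - 1).natAbs ∧ 2 ∣ (Q + 1).natAbs := by
  have h := hP.2.trans (divGcd_dvd _ _)
  rw [natAbs_sq_sub_one] at h
  rcases Nat.prime_two.dvd_mul.1 h with h | h <;> omega

/-- Makes the bound of `torsion_two_mul` sharp: all 2a-torsion is fixed by Q and meets the torsion
condition of Q² − 1. -/
theorem two_mul_divGcd_dvd_of_twoCond (hQ : 2 ≤ Q.natAbs) (hP : TwoCond Q k) :
    2 * divGcd (Q - 1).natAbs k ∣ (Q - 1).natAbs ∧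
      2 * divGcd (Q - 1).natAbs k ∣ divGcd (Q ^ 2 - 1).natAbs k := by
  have h := odd_of_twoCond hP
  refine ⟨two_mul_divGcd_dvd hP.1 h.1, ?_⟩
  have := hP.2
  rw [natAbs_sq_sub_one] at this ⊢
  exact two_mul_divGcd_dvd_divGcd_mul (by omega) h.2 this

theorem natAbs_dvd_of_mul_eq {m n : ℤ} (h : (N : ℤ) = m * n) : m.natAbs ∣ N :=
  Int.natCast_dvd_natCast.1 (by rw [Int.natAbs_dvd, h]; exact dvd_mul_right _ _)

theorem natAbs_sub_one_dvd (hN : (N : ℤ) = Q ^ 6 - 1) : (Q - 1).natAbs ∣ N :=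
  natAbs_dvd_of_mul_eq (n := (Q + 1) * (Q ^ 2 + Q + 1) * (Q ^ 2 - Q + 1)) (by rw [hN]; ring)

theorem natAbs_sq_sub_one_dvd (hN : (N : ℤ) = Q ^ 6 - 1) : (Q ^ 2 - 1).natAbs ∣ N :=
  natAbs_dvd_of_mul_eq (n := (Q ^ 2 + Q + 1) * (Q ^ 2 - Q + 1)) (by rw [hN]; ring)

theorem natAbs_sq_add_add_one_dvd (hN : (N : ℤ) = Q ^ 6 - 1) : (Q ^ 2 + Q + 1).natAbs ∣ N :=
  natAbs_dvd_of_mul_eq (n := (Q ^ 2 - 1) * (Q ^ 2 - Q + 1)) (by rw [hN]; ring)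

variable [NeZero N]

theorem tripleCount_or_add_and (p p' : ZMod N → ZMod N → ZMod N → Prop) :
    tripleCount (fun x y z => p x y z ∨ p' x y z) + tripleCount (fun x y z => p x y z ∧ p' x y z) =
      tripleCount p + tripleCount p' :=
  Set.ncard_union_add_ncard_inter _ _

theorem tripleCount_or {p p' : ZMod N → ZMod N → ZMod N → Prop}
    (h : ∀ x y z, x + y + z = 0 → p x y z → ¬ p' x y z) :
    tripleCount (fun x y z => p x y z ∨ p' x y z) = tripleCount p + tripleCount p' :=
  Set.ncard_union_eq (Set.disjoint_left.2 fun _ => h _ _ _ (by ring))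

theorem tripleCount_torsTriple {n : ℕ} (hn : n ∣ N) :
    tripleCount (N := N) (TorsTriple n) = n ^ 2 := by
  have h : {v : ZMod N × ZMod N | TorsTriple n v.1 v.2 (-v.1 - v.2)} =
      {x : ZMod N | (n : ZMod N) * x = 0} ×ˢ {x : ZMod N | (n : ZMod N) * x = 0} := by
    ext ⟨x, y⟩
    constructor
    · rintro ⟨h1, h2, -⟩
      exact ⟨h1, h2⟩
    · rintro ⟨h1, h2⟩
      rw [Set.mem_ofPred_eq] at h1 h2
      exact ⟨h1, h2, by linear_combination -h1 - h2⟩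
  rw [tripleCount, h, Set.ncard_prod, ZMod.ncard_mul_eq_zero hn, sq]

theorem ZMod.ncard_two_mul_of_not {n : ℕ} (hn : 2 * n ∣ N) :
    {x : ZMod N | ((2 * n : ℕ) : ZMod N) * x = 0 ∧ (n : ZMod N) * x ≠ 0}.ncard = n := by
  have h1 := ZMod.ncard_mul_eq_zero hn
  have h2 := ZMod.ncard_mul_eq_zero ((Nat.dvd_mul_left n 2).trans hn)
  have h3 := Set.ncard_sdiff_add_ncard_of_subset (s := {x : ZMod N | (n : ZMod N) * x = 0})
    (t := {x : ZMod N | ((2 * n : ℕ) : ZMod N) * x = 0})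
    (fun x hx => ZMod.natCast_mul_eq_zero_of_dvd (Nat.dvd_mul_left n 2) hx)
  rw [h1, h2] at h3
  have h4 : {x : ZMod N | ((2 * n : ℕ) : ZMod N) * x = 0} \ {x : ZMod N | (n : ZMod N) * x = 0} =
      {x : ZMod N | ((2 * n : ℕ) : ZMod N) * x = 0 ∧ (n : ZMod N) * x ≠ 0} := rfl
  rw [h4] at h3
  omega

theorem ZMod.ncard_two_torsion_of_not {n : ℕ} (hN : 2 ∣ N) :
    {x : ZMod N | 2 * x = 0 ∧ (n : ZMod N) * x ≠ 0}.ncard = if 2 ∣ n then 0 else 1 := by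
  split_ifs with h
  · rw [Set.ncard_eq_zero, Set.eq_empty_iff_forall_notMem]
    rintro x ⟨h2, hx⟩
    exact hx (ZMod.natCast_mul_eq_zero_of_dvd h (by exact_mod_cast h2))
  · have h1 := ZMod.ncard_two_mul_of_not (N := N) (n := 1) (by simpa using hN)
    refine Eq.trans (congrArg Set.ncard (Set.ext fun x => ?_)) h1
    rw [Set.mem_ofPred_eq, Set.mem_ofPred_eq]
    push_cast
    rw [one_mul]
    refine and_congr_right fun h2 => not_congr ⟨fun hx => ?_, fun hx => by simp [hx]⟩
    by_contra hx0
    exact h (ZMod.prime_dvd_of_mul_eq_zero Nat.prime_two hx0 (by exact_mod_cast h2) hx)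

/-- The lines y = x and y = −x each contribute n points. They share those with 2x = 0 and n x ≠ 0:
one if n is odd, none otherwise. -/
theorem tripleCount_wallPair {n : ℕ} (hn : 2 * n ∣ N) :
    tripleCount (N := N) (WallPair n) + (if 2 ∣ n then 0 else 1) = 2 * n := by
  rw [← ZMod.ncard_two_torsion_of_not (N := N) (n := n) ((Nat.dvd_mul_right 2 n).trans hn)]
  have h1 := tripleCount_or_add_and
    (fun x y _ => (((2 * n : ℕ) : ZMod N) * x = 0 ∧ (n : ZMod N) * x ≠ 0) ∧ y = x)
    (fun x y _ => (((2 * n : ℕ) : ZMod N) * x = 0 ∧ (n : ZMod N) * x ≠ 0) ∧ y = -x)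
  have h2 := tripleCount_graph
    (fun x => ((2 * n : ℕ) : ZMod N) * x = 0 ∧ (n : ZMod N) * x ≠ 0) (fun x => x)
  have h3 := tripleCount_graph
    (fun x => ((2 * n : ℕ) : ZMod N) * x = 0 ∧ (n : ZMod N) * x ≠ 0) (fun x => -x)
  have h4 := tripleCount_graph (fun x => 2 * x = 0 ∧ (n : ZMod N) * x ≠ 0) (fun x => x)
  rw [ZMod.ncard_two_mul_of_not hn] at h2 h3
  rw [h2, h3] at h1
  rw [← h4, two_mul, ← h1]
  refine congrArg₂ _ (tripleCount_congr fun x y z _ => ?_) (tripleCount_congr fun x y z _ => ?_)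
  · rw [WallPair, and_or_left]
  · constructor
    · rintro ⟨⟨hx, hnx⟩, rfl⟩
      refine ⟨⟨⟨?_, hnx⟩, rfl⟩, ⟨⟨?_, hnx⟩, by linear_combination hx⟩⟩ <;>
      · push_cast; linear_combination (n : ZMod N) * hx
    · rintro ⟨⟨⟨-, hnx⟩, rfl⟩, ⟨-, h⟩⟩
      exact ⟨⟨by linear_combination h, hnx⟩, rfl⟩

theorem tripleCount_fixId (hQ : 2 ≤ Q.natAbs) (hN : (N : ℤ) = Q ^ 6 - 1) :
    tripleCount (N := N) (fun x y z => FixId Q x y z ∧ SignedPermTriple Q k x y z) +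
        (if TwoCond Q k then 3 * (if 2 ∣ divGcd (Q - 1).natAbs k then 0 else 1) else 0) =
      divGcd (Q - 1).natAbs k ^ 2 +
        (if TwoCond Q k then 6 * divGcd (Q - 1).natAbs k else 0) := by
  have haN := (divGcd_dvd _ k).trans (natAbs_sub_one_dvd hN)
  have hcount := tripleCount_torsTriple haN
  by_cases hP : TwoCond Q k
  · rw [if_pos hP, if_pos hP]
    obtain ⟨ha, hb⟩ := two_mul_divGcd_dvd_of_twoCond hQ hP
    have hw := tripleCount_wallPair (ha.trans (natAbs_sub_one_dvd hN))
    set a := divGcd (Q - 1).natAbs k with ha'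
    have key : ∀ x y z : ZMod N, x + y + z = 0 →
        ((FixId Q x y z ∧ SignedPermTriple Q k x y z) ↔ (TorsTriple a x y z ∨
          (WallPair a x y z ∨ (WallPair a y z x ∨ WallPair a z x y)))) := by
      intro x y z h0
      have h0' : y + z + x = 0 := by linear_combination h0
      have h0'' : z + x + y = 0 := by linear_combination h0
      constructor
      · rintro ⟨hf, hs⟩
        rw [signedPermTriple_iff_of_fixId hQ h0 hf] at hs
        rcases hs with hs | ⟨ht, hs⟩
        · exact .inl hs
        · exact torsTriple_or_wallPairs h0 ⟨torsion_two_mul hQ hf.1 ht.1,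
            torsion_two_mul hQ hf.2.1 ht.2.1, torsion_two_mul hQ hf.2.2 ht.2.2⟩ hs
      · have hwall : TorsTriple (2 * a) x y z → OnWall x y z →
            FixId Q x y z ∧ SignedPermTriple Q k x y z := fun ht hs =>
          ⟨ht.fixId ha, (signedPermTriple_iff_of_fixId hQ h0 (ht.fixId ha)).2
            (.inr ⟨ht.of_dvd hb, hs⟩)⟩
        rintro (h | h | h | h)
        · have hf := h.fixId (divGcd_dvd _ k)
          exact ⟨hf, (signedPermTriple_iff_of_fixId hQ h0 hf).2 (.inl h)⟩
        · exact hwall (h.torsTriple h0) (h.onWall h0)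
        · exact hwall (TorsTriple.rotate_iff.1 (h.torsTriple h0')) (h.onWall h0').rotate.rotate
        · exact hwall (TorsTriple.rotate_iff.1 (TorsTriple.rotate_iff.1 (h.torsTriple h0'')))
            (h.onWall h0'').rotate
    -- The four sets are disjoint: a torsion triple has all coordinates killed by a, a wall pair
    -- only its last one, and the three wall pairs have different last coordinates.
    rw [tripleCount_congr key, tripleCount_or, tripleCount_or, tripleCount_or, hcount,
      tripleCount_rotate (WallPair a), tripleCount_rotate (fun x y z => WallPair a y z x),
      tripleCount_rotate (WallPair a)]
    · omega
    · intro x y z h0 h h'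
      exact h'.mul_ne_zero.2 (h.last_mul_eq_zero (by linear_combination h0))
    · rintro x y z h0 h (h' | h')
      · exact h'.mul_ne_zero.2 (h.last_mul_eq_zero h0)
      · exact h'.mul_ne_zero.1 (h.last_mul_eq_zero h0)
    · rintro x y z h0 h (h' | h' | h')
      · exact h'.mul_ne_zero.1 h.1
      · exact h'.mul_ne_zero.1 h.2.1
      · exact h'.mul_ne_zero.2 h.1
  · rw [if_neg hP, if_neg hP, ← hcount, add_zero, add_zero]
    refine tripleCount_congr fun x y z h0 => ⟨?_, fun h => ?_⟩
    · rintro ⟨hf, hs⟩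
      rw [signedPermTriple_iff_of_fixId hQ h0 hf] at hs
      rcases hs with hs | ⟨ht, -⟩
      · exact hs
      · exact ⟨torsion_of_not_twoCond hQ hP hf.1 ht.1,
          torsion_of_not_twoCond hQ hP hf.2.1 ht.2.1, torsion_of_not_twoCond hQ hP hf.2.2 ht.2.2⟩
    · have hf := h.fixId (divGcd_dvd _ k)
      exact ⟨hf, (signedPermTriple_iff_of_fixId hQ h0 hf).2 (.inl h)⟩

theorem tripleCount_fixSwap (hQ : 2 ≤ Q.natAbs) (hN : (N : ℤ) = Q ^ 6 - 1) :
    tripleCount (N := N) (fun x y z => FixSwap Q x y z ∧ SignedPermTriple Q k x y z) =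
      divGcd (Q ^ 2 - 1).natAbs k := by
  have hbN := (divGcd_dvd _ k).trans (natAbs_sq_sub_one_dvd hN)
  rw [← ZMod.ncard_mul_eq_zero hbN, ← tripleCount_graph _ (fun x => (Q : ZMod N) * x)]
  refine tripleCount_congr fun x y z h0 => ?_
  constructor
  · rintro ⟨hf, hs⟩
    rw [signedPermTriple_iff_of_fixSwap hQ h0 hf] at hs
    exact ⟨hs.1, hf.1.symm⟩
  · rintro ⟨hx, rfl⟩
    have hx' := ZMod.natCast_mul_eq_zero_of_dvd (divGcd_dvd _ k) hx
    rw [ZMod.natAbs_mul_eq_zero_iff] at hx'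
    push_cast at hx'
    have hf : FixSwap Q x (Q * x) z :=
      ⟨rfl, by linear_combination hx', by linear_combination (Q - 1 : ZMod N) * h0 - hx'⟩
    refine ⟨hf, (signedPermTriple_iff_of_fixSwap hQ h0 hf).2 ⟨hx, ?_, ?_⟩⟩
    · linear_combination (Q : ZMod N) * hx
    · linear_combination (-Q - 1 : ZMod N) * hx + (divGcd (Q ^ 2 - 1).natAbs k : ZMod N) * h0

theorem tripleCount_fixRot (hQ : 2 ≤ Q.natAbs) (hN : (N : ℤ) = Q ^ 6 - 1) :
    tripleCount (N := N) (fun x y z => FixRot Q x y z ∧ SignedPermTriple Q k x y z) =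
      divGcd (Q ^ 2 + Q + 1).natAbs k +
        if 3 ∣ k ∧ 3 ∣ divGcd (Q - 1).natAbs k then 2 else 0 := by
  have hcN := (divGcd_dvd _ k).trans (natAbs_sq_add_add_one_dvd hN)
  have h1 : tripleCount (N := N) (fun x y z => FixRot Q x y z ∧ SignedPermTriple Q k x y z) =
      tripleCount (N := N) (fun x y _ => ((divGcd (Q ^ 2 + Q + 1).natAbs k : ZMod N) * x = 0 ∨
        (3 ∣ k ∧ 3 ∣ divGcd (Q - 1).natAbs k ∧ 3 * x = 0)) ∧ y = (Q : ZMod N) * x) := by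
    refine tripleCount_congr fun x y z h0 => ?_
    constructor
    · rintro ⟨hf, hs⟩
      rw [signedPermTriple_iff_of_fixRot hQ h0 hf] at hs
      refine ⟨hs.imp (fun h => h.1) ?_, hf.1.symm⟩
      rintro ⟨h3, h3', rfl, rfl⟩
      exact ⟨h3, h3', by linear_combination h0⟩
    · rintro ⟨hx | ⟨h3, h3', hx⟩, rfl⟩
      · have hx' := ZMod.natCast_mul_eq_zero_of_dvd (divGcd_dvd _ k) hx
        rw [ZMod.natAbs_mul_eq_zero_iff] at hx'
        push_cast at hx'
        have hf : FixRot Q x (Q * x) z :=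
          ⟨rfl, by linear_combination hx' - h0,
            by linear_combination (Q : ZMod N) * h0 - hx'⟩
        refine ⟨hf, (signedPermTriple_iff_of_fixRot hQ h0 hf).2 (.inl ⟨hx, ?_, ?_⟩)⟩
        · linear_combination (Q : ZMod N) * hx
        · linear_combination (-Q - 1 : ZMod N) * hx +
            (divGcd (Q ^ 2 + Q + 1).natAbs k : ZMod N) * h0
      · have hQx : (Q : ZMod N) * x = x :=
          fixed_of_dvd (h3'.trans (divGcd_dvd _ k)) (by exact_mod_cast hx)
        obtain rfl : z = x := by linear_combination h0 - hQx - hx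
        rw [hQx]
        have hf : FixRot Q z z z := ⟨hQx, hQx, hQx⟩
        exact ⟨hf, (signedPermTriple_iff_of_fixRot hQ (by linear_combination hx) hf).2
          (.inr ⟨h3, h3', rfl, rfl⟩)⟩
  rw [h1, tripleCount_graph, Set.ofPred_or]
  split_ifs with h3
  -- When 3 ∣ k, the quotient c of Q² + Q + 1 is prime to 3, so the torsion groups of orders c and 3
  -- meet only in 0. The union has c + 3 − 1 elements.
  · have h4 := Set.ncard_union_add_ncard_inter
      {x : ZMod N | (divGcd (Q ^ 2 + Q + 1).natAbs k : ZMod N) * x = 0}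
      {x : ZMod N | 3 ∣ k ∧ 3 ∣ divGcd (Q - 1).natAbs k ∧ 3 * x = 0}
    have h5 : {x : ZMod N | 3 ∣ k ∧ 3 ∣ divGcd (Q - 1).natAbs k ∧ 3 * x = 0}.ncard = 3 := by
      have := ZMod.ncard_mul_eq_zero
        ((h3.2.trans (divGcd_dvd _ k)).trans (natAbs_sub_one_dvd hN))
      refine Eq.trans (congrArg Set.ncard (Set.ext fun x => ?_)) this
      rw [Set.mem_ofPred_eq, Set.mem_ofPred_eq]
      push_cast
      tauto
    have h6 : {x : ZMod N | (divGcd (Q ^ 2 + Q + 1).natAbs k : ZMod N) * x = 0} ∩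
        {x : ZMod N | 3 ∣ k ∧ 3 ∣ divGcd (Q - 1).natAbs k ∧ 3 * x = 0} = {0} := by
      ext x
      constructor
      · rintro ⟨hx, -, -, hx3⟩
        by_contra hx0
        exact not_three_dvd_of_three_dvd_divGcd (ZMod.prime_dvd_of_mul_eq_zero Nat.prime_three
          hx0 (by exact_mod_cast hx3) hx) h3.1
      · rintro rfl
        simp [h3]
    rw [h5, h6, Set.ncard_singleton, ZMod.ncard_mul_eq_zero hcN] at h4
    omega
  · have h5 : {x : ZMod N | 3 ∣ k ∧ 3 ∣ divGcd (Q - 1).natAbs k ∧ 3 * x = 0} = ∅ := by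
      rw [Set.eq_empty_iff_forall_notMem]
      exact fun x h => h3 ⟨h.1, h.2.1⟩
    rw [h5, Set.union_empty, ZMod.ncard_mul_eq_zero hcN, add_zero]

end Count

/-! ### Orbit counting -/

/-- Burnside-type count: if a finite group `W` acts on `X`, the map `Φ` separates exactly the orbits
in the finite stable set `U`, and `f` sends every point of `U` into its orbit, then the image
`Φ(U)` is counted by the points of `U` at which `f` agrees with a group element. -/
theorem card_mul_ncard_image {W X Y : Type*} [Group W] [Fintype W] [MulAction W X] [Finite X]
    (U : Set X) (f : X → X) (Φ : X → Y)
    (hU : ∀ (w : W), ∀ s ∈ U, w • s ∈ U) (hf : ∀ s ∈ U, ∃ w : W, f s = w • s)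
    (hΦ : ∀ (w : W), ∀ s ∈ U, Φ (w • s) = Φ s)
    (hΦ' : ∀ s ∈ U, ∀ t ∈ U, Φ s = Φ t → ∃ w : W, t = w • s) :
    Fintype.card W * (Φ '' U).ncard = ∑ w : W, {s | f s = w • s ∧ s ∈ U}.ncard := by
  classical
  have := Fintype.ofFinite X
  set V : Finset X := Finset.univ.filter (· ∈ U) with hV
  have hVU : ∀ s, s ∈ V ↔ s ∈ U := fun s => by simp [hV]
  have h1 : ∀ w : W, {s | f s = w • s ∧ s ∈ U}.ncard =
      (V.filter fun s => f s = w • s).card := by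
    intro w
    rw [← Set.ncard_coe_finset]
    congr 1
    ext s
    simp [hV, and_comm]
  have h2 : (Φ '' U).ncard = (V.image Φ).card := by
    rw [← Set.ncard_coe_finset]
    congr 1
    ext s
    simp [hV]
  simp_rw [h1, h2]
  have h3 : ∑ w : W, (V.filter fun s => f s = w • s).card =
      ∑ s ∈ V, (Finset.univ.filter fun w : W => f s = w • s).card :=
    Finset.sum_card_bipartiteAbove_eq_sum_card_bipartiteBelow (fun (w : W) s => f s = w • s)
  rw [h3, ← Finset.sum_fiberwise_of_maps_to (g := Φ) (t := V.image Φ)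
    (fun s hs => Finset.mem_image_of_mem _ hs), mul_comm, ← smul_eq_mul, ← Finset.sum_const]
  refine Finset.sum_congr rfl fun y hy => ?_
  obtain ⟨s₀, hs₀, rfl⟩ := Finset.mem_image.1 hy
  rw [hVU] at hs₀
  -- Sort the elements w of W by the point s = w s₀ of the fibre. The sets `{w | w • s₀ = s}` and
  -- `{w | f s = w • s}` are both cosets for the stabiliser of s, hence of equal size.
  rw [← Finset.card_univ, Finset.card_eq_sum_card_fiberwise (f := fun w : W => w • s₀)
    (t := V.filter fun s => Φ s = Φ s₀)]
  · refine Finset.sum_congr rfl fun s hs => ?_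
    rw [Finset.mem_filter, hVU] at hs
    obtain ⟨g, rfl⟩ := hΦ' s₀ hs₀ s hs.1 hs.2.symm
    obtain ⟨w₁, hw₁⟩ := hf _ hs.1
    refine Finset.card_bij' (fun w _ => w₁ * w * g⁻¹) (fun w _ => w₁⁻¹ * w * g) ?_ ?_ ?_ ?_
    · intro w hw
      simp only [Finset.mem_filter, Finset.mem_univ, true_and] at hw ⊢
      rw [hw₁, mul_smul, mul_smul, inv_smul_smul, hw]
    · intro w hw
      simp only [Finset.mem_filter, Finset.mem_univ, true_and] at hw ⊢
      rw [mul_smul, mul_smul, ← hw, hw₁, inv_smul_smul]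
    · intro w _; group
    · intro w _; group
  · intro w _
    simp only [Finset.coe_filter, Set.mem_ofPred_eq, hVU]
    exact ⟨hU w s₀ hs₀, hΦ w s₀ hs₀⟩

/-! ### The Weyl group S₃ × {±1} acting on triples -/

section Weyl

variable {R : Type*} [CommRing R]

/-- The Weyl group of `G₂` acts on triples by permutations and a common sign. -/
instance weylAction : MulAction (Equiv.Perm (Fin 3) × ℤˣ) (Fin 3 → R) where
  smul w s := fun i => ((w.2 : ℤ) : R) * s (w.1⁻¹ i)
  one_smul s := by
    funext i
    change (((1 : ℤˣ) : ℤ) : R) * s ((1 : Equiv.Perm (Fin 3))⁻¹ i) = s i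
    simp
  mul_smul w w' s := by
    funext i
    change (((w.2 * w'.2 : ℤˣ) : ℤ) : R) * s ((w.1 * w'.1)⁻¹ i) =
      ((w.2 : ℤ) : R) * (((w'.2 : ℤ) : R) * s (w'.1⁻¹ (w.1⁻¹ i)))
    simp [mul_assoc]

theorem weyl_smul_apply (w : Equiv.Perm (Fin 3) × ℤˣ) (s : Fin 3 → R) (i : Fin 3) :
    (w • s) i = ((w.2 : ℤ) : R) * s (w.1⁻¹ i) := rfl

theorem weyl_smul_mul (w : Equiv.Perm (Fin 3) × ℤˣ) (c : R) (s : Fin 3 → R) :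
    (w • fun i => c * s i) = fun i => c * (w • s) i := by
  funext i
  rw [weyl_smul_apply, weyl_smul_apply]
  ring

theorem weyl_smul_sum_eq_zero (w : Equiv.Perm (Fin 3) × ℤˣ) {s : Fin 3 → R}
    (h : s 0 + s 1 + s 2 = 0) : (w • s) 0 + (w • s) 1 + (w • s) 2 = 0 := by
  rw [← Fin.sum_univ_three] at h ⊢
  simp only [weyl_smul_apply]
  rw [← Finset.mul_sum, Equiv.sum_comp w.1⁻¹ s, h, mul_zero]

theorem perm_three_univ : (Finset.univ : Finset (Equiv.Perm (Fin 3))) =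
    {1, Equiv.swap 0 1, Equiv.swap 1 2, Equiv.swap 2 0, finRotate 3, (finRotate 3)⁻¹} := by
  decide

theorem sum_perm_three {M : Type*} [AddCommMonoid M] (g : Equiv.Perm (Fin 3) → M) :
    ∑ σ, g σ = g 1 + (g (Equiv.swap 0 1) + (g (Equiv.swap 1 2) + (g (Equiv.swap 2 0) +
      (g (finRotate 3) + g (finRotate 3)⁻¹)))) := by
  rw [perm_three_univ, Finset.sum_insert (by decide), Finset.sum_insert (by decide),
    Finset.sum_insert (by decide), Finset.sum_insert (by decide), Finset.sum_insert (by decide),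
    Finset.sum_singleton]

theorem exists_perm_three {p : Equiv.Perm (Fin 3) → Prop} :
    (∃ σ, p σ) ↔ p 1 ∨ p (Equiv.swap 0 1) ∨ p (Equiv.swap 1 2) ∨ p (Equiv.swap 2 0) ∨
      p (finRotate 3) ∨ p (finRotate 3)⁻¹ := by
  have h : (∃ σ, p σ) ↔ ∃ σ ∈ (Finset.univ : Finset (Equiv.Perm (Fin 3))), p σ := by simp
  rw [h, perm_three_univ]
  simp

theorem forall_mul_eq_perm_iff (Q : R) (s : Fin 3 → R) (σ : Equiv.Perm (Fin 3)) :
    (∀ i, Q * s i = s (σ⁻¹ i)) ↔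
      Q * s 0 = s (σ⁻¹ 0) ∧ Q * s 1 = s (σ⁻¹ 1) ∧ Q * s 2 = s (σ⁻¹ 2) := by
  rw [Fin.forall_fin_succ, Fin.forall_fin_succ, Fin.forall_fin_one]; rfl

end Weyl

/-! ### Summing over the Weyl group -/

section WeylCount

variable {N : ℕ} {Q : ℤ} {k : ℕ}

/-- Multiplication by `Q` acts on the triple as the permutation `σ`. -/
def FixPerm (Q : ℤ) (σ : Equiv.Perm (Fin 3)) (s : Fin 3 → ZMod N) : Prop :=
  ∀ i, (Q : ZMod N) * s i = s (σ⁻¹ i)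

theorem fixPerm_one (s : Fin 3 → ZMod N) : FixPerm Q 1 s ↔ FixId Q (s 0) (s 1) (s 2) :=
  forall_mul_eq_perm_iff _ _ _

theorem fixPerm_swap01 (s : Fin 3 → ZMod N) :
    FixPerm Q (Equiv.swap 0 1) s ↔ FixSwap Q (s 0) (s 1) (s 2) :=
  forall_mul_eq_perm_iff _ _ _

theorem fixPerm_swap12 (s : Fin 3 → ZMod N) :
    FixPerm Q (Equiv.swap 1 2) s ↔ FixSwap Q (s 1) (s 2) (s 0) :=
  (forall_mul_eq_perm_iff _ _ _).trans
    ⟨fun h => ⟨h.2.1, h.2.2, h.1⟩, fun h => ⟨h.2.2, h.1, h.2.1⟩⟩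

theorem fixPerm_swap20 (s : Fin 3 → ZMod N) :
    FixPerm Q (Equiv.swap 2 0) s ↔ FixSwap Q (s 2) (s 0) (s 1) :=
  (forall_mul_eq_perm_iff _ _ _).trans
    ⟨fun h => ⟨h.2.2, h.1, h.2.1⟩, fun h => ⟨h.2.1, h.2.2, h.1⟩⟩

/-- The action involves σ⁻¹, so the cycle runs backwards. -/
theorem fixPerm_rotate (s : Fin 3 → ZMod N) :
    FixPerm Q (finRotate 3) s ↔ FixRot Q (s 0) (s 2) (s 1) :=
  (forall_mul_eq_perm_iff _ _ _).trans
    ⟨fun h => ⟨h.1, h.2.2, h.2.1⟩, fun h => ⟨h.1, h.2.2, h.2.1⟩⟩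

theorem fixPerm_rotate_inv (s : Fin 3 → ZMod N) :
    FixPerm Q (finRotate 3)⁻¹ s ↔ FixRot Q (s 0) (s 1) (s 2) :=
  forall_mul_eq_perm_iff _ _ _

theorem exists_fin_three {R : Type*} {p : (Fin 3 → R) → Prop} :
    (∃ s, p s) ↔ ∃ x y z, p ![x, y, z] := by
  constructor
  · rintro ⟨s, hs⟩
    refine ⟨s 0, s 1, s 2, ?_⟩
    convert hs using 1
    funext i; fin_cases i <;> rfl
  · rintro ⟨x, y, z, h⟩
    exact ⟨_, h⟩

theorem exists_perm_fixPerm_iff [NeZero N] (hN : (N : ℤ) = Q ^ 6 - 1) (s : Fin 3 → ZMod N)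
    (h0 : s 0 + s 1 + s 2 = 0) :
    (∃ σ, ∃ s' : Fin 3 → ZMod N, s' 0 + s' 1 + s' 2 = 0 ∧ FixPerm Q σ s' ∧
      (k : ZMod N) * s' 0 = s 0 ∧ (k : ZMod N) * s' 1 = s 1 ∧ (k : ZMod N) * s' 2 = s 2) ↔
    PermTriple Q k (s 0) (s 1) (s 2) := by
  have h0' : s 1 + s 2 + s 0 = 0 := by linear_combination h0
  have h0'' : s 2 + s 0 + s 1 = 0 := by linear_combination h0
  have h0f : s 0 + s 2 + s 1 = 0 := by linear_combination h0
  rw [exists_perm_three, PermTriple]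
  simp only [fixPerm_one, fixPerm_swap01, fixPerm_swap12, fixPerm_swap20, fixPerm_rotate,
    fixPerm_rotate_inv, exists_fin_three, Matrix.cons_val_zero, Matrix.cons_val_one,
    Matrix.cons_val]
  have hid := exists_fixId_iff (k := k) (natAbs_sub_one_dvd hN) h0
  have hs1 := exists_fixSwap_iff (k := k) (natAbs_sq_sub_one_dvd hN) h0
  have hs2 := exists_fixSwap_iff (k := k) (natAbs_sq_sub_one_dvd hN) h0'
  have hs3 := exists_fixSwap_iff (k := k) (natAbs_sq_sub_one_dvd hN) h0''
  have hr1 := exists_fixRot_iff (k := k) (natAbs_sq_add_add_one_dvd hN) h0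
  have hr2 := exists_fixRot_iff (k := k) (natAbs_sq_add_add_one_dvd hN) h0f
  rw [TorsTriple.rotate_iff] at hs2
  rw [TorsTriple.rotate_iff, TorsTriple.rotate_iff] at hs3
  rw [TorsTriple.flip_iff] at hr2
  rw [hid, hs1, ← hs2, ← hs3, hr1, ← hr2]
  refine or_congr_right (or_congr_right (or_congr ?_ (or_congr ?_ (or_comm.trans
    (or_congr_right ?_)))))
  · constructor
    · rintro ⟨x, y, z, h, hf, hx, hy, hz⟩
      exact ⟨y, z, x, by linear_combination h, hf, hy, hz, hx⟩
    · rintro ⟨x, y, z, h, hf, hx, hy, hz⟩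
      exact ⟨z, x, y, by linear_combination h, hf, hz, hx, hy⟩
  · constructor
    · rintro ⟨x, y, z, h, hf, hx, hy, hz⟩
      exact ⟨z, x, y, by linear_combination h, hf, hz, hx, hy⟩
    · rintro ⟨x, y, z, h, hf, hx, hy, hz⟩
      exact ⟨y, z, x, by linear_combination h, hf, hy, hz, hx⟩
  · constructor <;>
    · rintro ⟨x, y, z, h, hf, hx, hy, hz⟩
      exact ⟨x, z, y, by linear_combination h, hf, hx, hz, hy⟩

theorem ncard_eq_tripleCount (p : ZMod N → ZMod N → ZMod N → Prop) :
    {s : Fin 3 → ZMod N | p (s 0) (s 1) (s 2) ∧ s 0 + s 1 + s 2 = 0}.ncard = tripleCount p := by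
  refine Set.ncard_congr (fun s _ => (s 0, s 1)) ?_ ?_ ?_
  · rintro s ⟨h, h0⟩
    have : s 2 = -s 0 - s 1 := by linear_combination h0
    rw [this] at h
    exact h
  · rintro s t ⟨-, h⟩ ⟨-, h'⟩ e
    rw [Prod.mk.injEq] at e
    obtain ⟨e0, e1⟩ := e
    funext i
    fin_cases i
    · exact e0
    · exact e1
    · change s 2 = t 2
      linear_combination h - h' - e0 - e1
  · rintro ⟨x, y⟩ h
    exact ⟨![x, y, -x - y], ⟨h, by simp⟩, rfl⟩

/-- The `k`-fold multiples of the triples of sum zero that multiplication by `q` moves within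
their orbit under the Weyl group. -/
def multipleSet (N q k : ℕ) : Set (Fin 3 → ZMod N) :=
  {s | ∃ s' : Fin 3 → ZMod N, s' 0 + s' 1 + s' 2 = 0 ∧
    (∃ w : Equiv.Perm (Fin 3) × ℤˣ, (fun i => (q : ZMod N) * s' i) = w • s') ∧
    s = fun i => (k : ZMod N) * s' i}

theorem mul_eq_weyl_smul_iff {q : ℕ} (w : Equiv.Perm (Fin 3) × ℤˣ) (s : Fin 3 → ZMod N) :
    (fun i => (q : ZMod N) * s i) = w • s ↔ FixPerm (w.2 * q) w.1 s := by
  rw [funext_iff, FixPerm]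
  refine forall_congr' fun i => ?_
  rw [weyl_smul_apply]
  rcases Int.units_eq_one_or w.2 with h | h <;> rw [h] <;> push_cast
  · simp
  · rw [neg_one_mul, neg_one_mul, neg_mul, neg_eq_iff_eq_neg]

theorem mem_multipleSet_iff [NeZero N] {q : ℕ} (hN : (N : ℤ) = (q : ℤ) ^ 6 - 1)
    (s : Fin 3 → ZMod N) :
    s ∈ multipleSet N q k ↔
      SignedPermTriple (q : ℤ) k (s 0) (s 1) (s 2) ∧ s 0 + s 1 + s 2 = 0 := by
  have hN' : (N : ℤ) = (-(q : ℤ)) ^ 6 - 1 := by rw [hN]; ring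
  have hmem : s ∈ multipleSet N q k ↔
      (∃ σ, ∃ s' : Fin 3 → ZMod N, s' 0 + s' 1 + s' 2 = 0 ∧ FixPerm q σ s' ∧
      (k : ZMod N) * s' 0 = s 0 ∧ (k : ZMod N) * s' 1 = s 1 ∧ (k : ZMod N) * s' 2 = s 2) ∨
      (∃ σ, ∃ s' : Fin 3 → ZMod N, s' 0 + s' 1 + s' 2 = 0 ∧ FixPerm (-q) σ s' ∧
      (k : ZMod N) * s' 0 = s 0 ∧ (k : ZMod N) * s' 1 = s 1 ∧ (k : ZMod N) * s' 2 = s 2) := by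
    have hfun : ∀ s' : Fin 3 → ZMod N, (k : ZMod N) * s' 0 = s 0 → (k : ZMod N) * s' 1 = s 1 →
        (k : ZMod N) * s' 2 = s 2 → s = fun i => (k : ZMod N) * s' i := by
      intro s' h0 h1 h2
      funext i
      fin_cases i
      · exact h0.symm
      · exact h1.symm
      · exact h2.symm
    constructor
    · rintro ⟨s', h0, ⟨⟨σ, ε⟩, hw⟩, rfl⟩
      rw [mul_eq_weyl_smul_iff] at hw
      rcases Int.units_eq_one_or ε with rfl | rfl
      · exact .inl ⟨σ, s', h0, by simpa using hw, rfl, rfl, rfl⟩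
      · exact .inr ⟨σ, s', h0, by simpa using hw, rfl, rfl, rfl⟩
    · rintro (⟨σ, s', h0, hw, h⟩ | ⟨σ, s', h0, hw, h⟩)
      · exact ⟨s', h0, ⟨(σ, 1), (mul_eq_weyl_smul_iff _ _).2 (by simpa using hw)⟩,
          hfun s' h.1 h.2.1 h.2.2⟩
      · exact ⟨s', h0, ⟨(σ, -1), (mul_eq_weyl_smul_iff _ _).2 (by simpa using hw)⟩,
          hfun s' h.1 h.2.1 h.2.2⟩
  have hsum : s ∈ multipleSet N q k → s 0 + s 1 + s 2 = 0 := by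
    rintro ⟨s', h0, -, rfl⟩
    linear_combination (k : ZMod N) * h0
  by_cases h0 : s 0 + s 1 + s 2 = 0
  · rw [hmem, exists_perm_fixPerm_iff hN s h0, exists_perm_fixPerm_iff hN' s h0,
      and_iff_left h0, SignedPermTriple]
  · exact iff_of_false (fun h => h0 (hsum h)) (fun h => h0 h.2)

theorem sum_ncard_fixPerm [NeZero N] (hQ : 2 ≤ Q.natAbs) (hN : (N : ℤ) = Q ^ 6 - 1) :
    ∑ σ, {s : Fin 3 → ZMod N | FixPerm Q σ s ∧ (SignedPermTriple Q k (s 0) (s 1) (s 2) ∧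
      s 0 + s 1 + s 2 = 0)}.ncard +
        (if TwoCond Q k then 3 * (if 2 ∣ divGcd (Q - 1).natAbs k then 0 else 1) else 0) =
      divGcd (Q - 1).natAbs k ^ 2 + (if TwoCond Q k then 6 * divGcd (Q - 1).natAbs k else 0) +
      3 * divGcd (Q ^ 2 - 1).natAbs k + 2 * (divGcd (Q ^ 2 + Q + 1).natAbs k +
        if 3 ∣ k ∧ 3 ∣ divGcd (Q - 1).natAbs k then 2 else 0) := by
  have hid := tripleCount_fixId (k := k) hQ hN
  have hs := tripleCount_fixSwap (k := k) hQ hN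
  have hr := tripleCount_fixRot (k := k) hQ hN
  have hs2 := tripleCount_rotate (N := N) (fun x y z => FixSwap Q x y z ∧ SignedPermTriple Q k x y z)
  have hs3 := tripleCount_rotate (N := N) (fun x y z => FixSwap Q y z x ∧ SignedPermTriple Q k y z x)
  have hr2 := tripleCount_flip (N := N) (fun x y z => FixRot Q x y z ∧ SignedPermTriple Q k x y z)
  simp only [SignedPermTriple.rotate_iff, SignedPermTriple.flip_iff] at hs2 hs3 hr2
  rw [sum_perm_three]
  simp only [fixPerm_one, fixPerm_swap01, fixPerm_swap12, fixPerm_swap20, fixPerm_rotate,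
    fixPerm_rotate_inv, ← and_assoc]
  rw [ncard_eq_tripleCount (fun x y z => FixId Q x y z ∧ SignedPermTriple Q k x y z),
    ncard_eq_tripleCount (fun x y z => FixSwap Q x y z ∧ SignedPermTriple Q k x y z),
    ncard_eq_tripleCount (fun x y z => FixSwap Q y z x ∧ SignedPermTriple Q k x y z),
    ncard_eq_tripleCount (fun x y z => FixSwap Q z x y ∧ SignedPermTriple Q k x y z),
    ncard_eq_tripleCount (fun x y z => FixRot Q x z y ∧ SignedPermTriple Q k x y z),
    ncard_eq_tripleCount (fun x y z => FixRot Q x y z ∧ SignedPermTriple Q k x y z)]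
  rw [hr2, hs3, hs2, hs, hr]
  omega

theorem twoCond_neg : TwoCond (-Q) k ↔ TwoCond Q k := by
  rw [TwoCond, TwoCond, neg_sq]

theorem sum_ncard_weyl [NeZero N] {q : ℕ} (hq : 2 ≤ q) (hN : (N : ℤ) = (q : ℤ) ^ 6 - 1) :
    ∑ w : Equiv.Perm (Fin 3) × ℤˣ,
      {s : Fin 3 → ZMod N | (fun i => (q : ZMod N) * s i) = w • s ∧ s ∈ multipleSet N q k}.ncard +
        (if TwoCond q k then 3 * ((if 2 ∣ divGcd (q - 1) k then 0 else 1) +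
          (if 2 ∣ divGcd (q + 1) k then 0 else 1)) else 0) =
      divGcd (q - 1) k ^ 2 + divGcd (q + 1) k ^ 2 +
        (if TwoCond q k then 6 * (divGcd (q - 1) k + divGcd (q + 1) k) else 0) +
      6 * divGcd (q ^ 2 - 1) k + 2 * divGcd (q ^ 2 + q + 1) k + 2 * divGcd (q ^ 2 - q + 1) k +
        (if 3 ∣ k ∧ 3 ∣ divGcd (q - 1) k then 4 else 0) +
        (if 3 ∣ k ∧ 3 ∣ divGcd (q + 1) k then 4 else 0) := by
  have hN' : (N : ℤ) = (-(q : ℤ)) ^ 6 - 1 := by rw [hN]; ring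
  -- The sign +1 contributes a, b, c through Q = q. The sign −1 contributes ã, b, c̃ through Q = −q.
  have h1 := sum_ncard_fixPerm (k := k) (N := N) (Q := q) (by simpa using hq) hN
  have h2 := sum_ncard_fixPerm (k := k) (N := N) (Q := -q) (by simpa using hq) hN'
  have e1 : ((q : ℤ) - 1).natAbs = q - 1 := by omega
  have e2 : (-(q : ℤ) - 1).natAbs = q + 1 := by omega
  have hqq : q ≤ q ^ 2 := Nat.le_self_pow (by norm_num) q
  have e3 : ((q : ℤ) ^ 2 - 1).natAbs = q ^ 2 - 1 := by
    zify [(by omega : 1 ≤ q ^ 2)]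
    rw [abs_of_nonneg]
    have : (q : ℤ) ≤ (q : ℤ) ^ 2 := by exact_mod_cast hqq
    omega
  have e4 : ((q : ℤ) ^ 2 + q + 1).natAbs = q ^ 2 + q + 1 := by
    have : ((q : ℤ) ^ 2 + q + 1) = ((q ^ 2 + q + 1 : ℕ) : ℤ) := by push_cast; ring
    rw [this, Int.natAbs_natCast]
  have e5 : ((-(q : ℤ)) ^ 2 + -q + 1).natAbs = q ^ 2 - q + 1 := by
    have : ((-(q : ℤ)) ^ 2 + -q + 1) = ((q ^ 2 - q + 1 : ℕ) : ℤ) := by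
      push_cast [Nat.cast_sub hqq]; ring
    rw [this, Int.natAbs_natCast]
  simp only [twoCond_neg, signedPermTriple_neg] at h2
  rw [e5, neg_sq] at h2
  rw [e1, e3, e4] at h1
  rw [e2, e3] at h2
  rw [Fintype.sum_prod_type_right, UnitsInt.univ, Finset.sum_insert (by decide),
    Finset.sum_singleton]
  simp only [mul_eq_weyl_smul_iff, mem_multipleSet_iff hN, Units.val_one, Units.val_neg, one_mul,
    neg_one_mul]
  split_ifs at h1 h2 ⊢ <;> omega

end WeylCount

/-! ### From the count to the rational formula -/

theorem gcd_two_eq (a : ℕ) : Nat.gcd a 2 = if 2 ∣ a then 2 else 1 := by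
  rw [Nat.gcd_comm]
  split_ifs with h
  · exact Nat.gcd_eq_left h
  · exact (Nat.prime_two.coprime_iff_not_dvd.2 h)

/-- A and B stand for evenness of a and ã. The correction 3([a odd] + [ã odd])/12 equals 1/(2a'ã')
unless both are even, which `hAB` excludes. -/
theorem eq_of_twelve_mul {P A B C D : Prop} [Decidable P] [Decidable A] [Decidable B] [Decidable C]
    [Decidable D] (hAB : P → ¬ (A ∧ B)) (hCD : ¬ (C ∧ D)) {n a a' b c c' : ℕ}
    (h : 12 * n + (if P then 3 * ((if A then 0 else 1) + (if B then 0 else 1)) else 0) =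
      a ^ 2 + a' ^ 2 + (if P then 6 * (a + a') else 0) + 6 * b + 2 * c + 2 * c' +
        (if C then 4 else 0) + (if D then 4 else 0)) :
    (n : ℚ) = (a : ℚ) ^ 2 / 12 + (a' : ℚ) ^ 2 / 12 + (b : ℚ) / 2 + (c : ℚ) / 6 + (c' : ℚ) / 6 +
      ((if P then ((a : ℚ) + a') / 2 -
        1 / (2 * ((if A then 2 else 1 : ℕ) : ℚ) * ((if B then 2 else 1 : ℕ) : ℚ)) else 0) +
      (if C ∨ D then 1 / 3 else 0)) := by
  have hQ := congrArg (Nat.cast : ℕ → ℚ) h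
  by_cases hP : P <;> by_cases hA : A <;> by_cases hB : B <;> by_cases hC : C <;> by_cases hD : D <;>
    simp only [hP, hA, hB, hC, hD, if_true, if_false, or_true, or_false] at hQ hAB hCD ⊢ <;>
    first
    | (exfalso; revert hAB hCD; simp; done)
    | (push_cast at hQ ⊢; linarith)

/-- Twelve times the formula for the cardinality of the value set. -/
theorem formula_of_twelve_mul {q k n : ℕ} (hq : 2 ≤ q)
    (h : 12 * n +
        (if TwoCond q k then 3 * ((if 2 ∣ divGcd (q - 1) k then 0 else 1) +
          (if 2 ∣ divGcd (q + 1) k then 0 else 1)) else 0) =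
      divGcd (q - 1) k ^ 2 + divGcd (q + 1) k ^ 2 +
        (if TwoCond q k then 6 * (divGcd (q - 1) k + divGcd (q + 1) k) else 0) +
      6 * divGcd (q ^ 2 - 1) k + 2 * divGcd (q ^ 2 + q + 1) k + 2 * divGcd (q ^ 2 - q + 1) k +
        (if 3 ∣ k ∧ 3 ∣ divGcd (q - 1) k then 4 else 0) +
        (if 3 ∣ k ∧ 3 ∣ divGcd (q + 1) k then 4 else 0)) :
    (n : ℚ) = (divGcd (q - 1) k : ℚ) ^ 2 / 12 + (divGcd (q + 1) k : ℚ) ^ 2 / 12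
        + (divGcd (q ^ 2 - 1) k : ℚ) / 2 + (divGcd (q ^ 2 + q + 1) k : ℚ) / 6
        + (divGcd (q ^ 2 - q + 1) k : ℚ) / 6 + g2Eta k q := by
  have hP : TwoCond q k ↔ 2 ∣ k ∧ 2 ∣ divGcd (q ^ 2 - 1) k := by
    rw [TwoCond]
    have e3 : ((q : ℤ) ^ 2 - 1).natAbs = q ^ 2 - 1 := by
      have := Nat.pow_le_pow_left hq 2
      zify [(by omega : 1 ≤ q ^ 2)]
      rw [abs_of_nonneg]
      have : (4 : ℤ) ≤ (q : ℤ) ^ 2 := by exact_mod_cast this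
      omega
    rw [e3]
  -- If k, a and ã were all even, 4 would divide both q − 1 and q + 1.
  have hnot : TwoCond q k → ¬ (2 ∣ divGcd (q - 1) k ∧ 2 ∣ divGcd (q + 1) k) := by
    rintro h ⟨h1, h2⟩
    have h3 := sq_dvd_of_dvd_divGcd h.1 h1
    have h4 := sq_dvd_of_dvd_divGcd h.1 h2
    omega
  have h3 : (3 ∣ k ∧ 3 ∣ divGcd (q - 1) k * divGcd (q + 1) k) ↔
      (3 ∣ k ∧ 3 ∣ divGcd (q - 1) k) ∨ (3 ∣ k ∧ 3 ∣ divGcd (q + 1) k) := by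
    rw [Nat.prime_three.dvd_mul, and_or_left]
  have h3' : ¬ ((3 ∣ k ∧ 3 ∣ divGcd (q - 1) k) ∧ (3 ∣ k ∧ 3 ∣ divGcd (q + 1) k)) := by
    rintro ⟨⟨-, h1⟩, -, h2⟩
    have := h1.trans (divGcd_dvd _ _)
    have := h2.trans (divGcd_dvd _ _)
    omega
  have key := eq_of_twelve_mul hnot h3' h
  simp only [g2Eta, gcd_two_eq]
  simp only [hP, ← h3] at key
  exact key

theorem g2Eta_eq_zero {k q : ℕ} (h : Nat.gcd k 6 = 1) : g2Eta k q = 0 := by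
  have h2 : ¬ 2 ∣ k := fun h' => by
    have := Nat.dvd_gcd h' (by norm_num : 2 ∣ 6)
    omega
  have h3 : ¬ 3 ∣ k := fun h' => by
    have := Nat.dvd_gcd h' (by norm_num : 3 ∣ 6)
    omega
  simp [g2Eta, h2, h3]

/-! ### The folding polynomials over an arbitrary field -/

section Explicit

variable {K : Type*} [Field K]

/-- The orbit sums of the two fundamental weights of `G₂`, on the torus over a field. -/
def torusPhi (u v : K) : Fin 2 → K :=
  ![u + v + u * v + u⁻¹ + v⁻¹ + u⁻¹ * v⁻¹,
    u ^ 2 * v + u * v ^ 2 + u * v⁻¹ + u⁻¹ ^ 2 * v⁻¹ + u⁻¹ * v⁻¹ ^ 2 + u⁻¹ * v]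

/-- The recursion is Newton's identities for the six exponentials. Their elementary symmetric
functions are palindromic: x, x + y + 3, x² − 2y − 4, x + y + 3, x, 1. -/
theorem aeval_torusPhi_g2Aux {u v : K} (hu0 : u ≠ 0) (hv0 : v ≠ 0) (n : ℕ) :
    aeval (torusPhi u v) (g2Aux n) =
      u ^ n + v ^ n + (u * v) ^ n + u⁻¹ ^ n + v⁻¹ ^ n + (u⁻¹ * v⁻¹) ^ n := by
  induction n using g2Aux.induct with
  | case1 => simp [g2Aux]; norm_num
  | case2 => simp [g2Aux, torusPhi]
  | case3 => simp [g2Aux, torusPhi]; field_simp; ring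
  | case4 => simp [g2Aux, torusPhi]; field_simp; ring
  | case5 h3 h2 =>
    simp only [g2Aux.eq_5, map_sub, map_add, map_mul, map_pow, h3, h2, aeval_X, map_ofNat]
    simp [torusPhi]; field_simp; ring
  | case6 h4 h3 h2 =>
    simp only [g2Aux.eq_6, map_sub, map_add, map_mul, map_pow, h4, h3, h2, aeval_X, map_ofNat]
    simp [torusPhi]; field_simp; ring
  | case7 n h5 h4 h3 h2 h1 h0 =>
    simp only [g2Aux.eq_7, map_sub, map_add, map_mul, map_pow, h5, h4, h3, h2, h1, h0, aeval_X,
      map_ofNat]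
    simp only [torusPhi, Matrix.cons_val_zero, Matrix.cons_val_one, Matrix.cons_val_fin_one,
      Nat.succ_eq_add_one, pow_add, mul_pow]
    generalize u ^ n = U
    generalize v ^ n = V
    generalize u⁻¹ ^ n = A
    generalize v⁻¹ ^ n = B
    field_simp
    ring

/-- An explicit form of the folding polynomials. -/
noncomputable def g2Explicit (k : ℕ) : Fin 2 → MvPolynomial (Fin 2) ℤ :=
  ![g2Aux k, bind₁ ![X 1, g2Aux 3] (g2Aux k)]

theorem aeval_torusPhi_g2Explicit {u v : K} (hu : u ≠ 0) (hv : v ≠ 0) (k : ℕ) (i : Fin 2) :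
    aeval (torusPhi u v) (g2Explicit k i) = torusPhi (u ^ k) (v ^ k) i := by
  fin_cases i
  · simp only [Fin.zero_eta, g2Explicit, Matrix.cons_val_zero, aeval_torusPhi_g2Aux hu hv]
    simp only [torusPhi, Matrix.cons_val_zero]
    ring
  -- The exponentials in φ₂ form a system of the same shape with generators u v² and u v⁻¹; its own
  -- second orbit sum is the sum of cubes of the original six.
  · have key : (fun i => aeval (torusPhi u v)
        ((![X 1, g2Aux 3] : Fin 2 → MvPolynomial (Fin 2) ℤ) i)) =
        torusPhi (u * v ^ 2) (u * v⁻¹) := by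
      funext j
      fin_cases j
      · simp [torusPhi]; field_simp; ring
      · simp only [Fin.mk_one, Matrix.cons_val_one, Matrix.cons_val_fin_one,
          aeval_torusPhi_g2Aux hu hv 3]
        simp [torusPhi]; field_simp; ring
    simp only [Fin.mk_one, g2Explicit, Matrix.cons_val_one, Matrix.cons_val_fin_one, aeval_bind₁]
    rw [key, aeval_torusPhi_g2Aux (mul_ne_zero hu (pow_ne_zero 2 hv))
      (mul_ne_zero hu (inv_ne_zero hv))]
    have e : u * v ^ 2 * (u * v⁻¹) = u ^ 2 * v := by field_simp
    have e' : (u * v ^ 2)⁻¹ * (u * v⁻¹)⁻¹ = (u ^ 2 * v)⁻¹ := by rw [← mul_inv, e]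
    rw [e, e']
    simp only [torusPhi, Matrix.cons_val_one, Matrix.cons_val_fin_one, mul_inv, mul_pow, inv_pow,
      inv_inv, ← pow_mul]
    ring

end Explicit

theorem isG2Folding_g2Explicit (k : ℕ) : IsG2Folding k (g2Explicit k) := by
  intro σ τ
  have hinv : ∀ t, expTwoPiI (-t) = (expTwoPiI t)⁻¹ := fun t =>
    eq_inv_of_mul_eq_one_right (expTwoPiI_mul_neg t)
  have h : ∀ n : ℕ, g2Phi (n * σ) (n * τ) = torusPhi (expTwoPiI σ ^ n) (expTwoPiI τ ^ n) := by
    intro n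
    rw [g2Phi_nat_mul, torusPhi]
    simp only [hinv, inv_pow]
  have h1 := h 1
  simp only [Nat.cast_one, one_mul, pow_one] at h1
  funext i
  rw [h1, h k]
  exact aeval_torusPhi_g2Explicit (left_ne_zero_of_mul_eq_one (expTwoPiI_mul_neg σ))
    (left_ne_zero_of_mul_eq_one (expTwoPiI_mul_neg τ)) k i

/-- Uniqueness over ℂ transfers the power-map identity, proved for the explicit polynomials over any
field, to 𝒢_k. -/
theorem g2Folding_eq_g2Explicit (k : ℕ) : g2Folding k = g2Explicit k :=
  (existsUnique_isG2Folding k).unique (g2Folding_spec k) (isG2Folding_g2Explicit k)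

/-! ### Φ separates Weyl orbits and is onto -/

section Invariants

variable {K : Type*} [Field K]

/-- The orbit sums as symmetric functions of a triple of torus coordinates. -/
def triplePhi (p : Fin 3 → K) : Fin 2 → K :=
  ![(∑ i, p i) + ∑ i, (p i)⁻¹, (∑ i, p i) * (∑ i, (p i)⁻¹) - 3]

theorem triplePhi_perm (p : Fin 3 → K) (σ : Equiv.Perm (Fin 3)) :
    triplePhi (fun i => p (σ i)) = triplePhi p := by
  rw [triplePhi, triplePhi, Equiv.sum_comp σ p, Equiv.sum_comp σ fun i => (p i)⁻¹]

theorem triplePhi_inv (p : Fin 3 → K) : triplePhi (fun i => (p i)⁻¹) = triplePhi p := by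
  simp only [triplePhi, inv_inv]
  rw [add_comm, mul_comm]

theorem torusPhi_eq_triplePhi {u v : K} (hu : u ≠ 0) (hv : v ≠ 0) :
    torusPhi u v = triplePhi ![u, v, u⁻¹ * v⁻¹] := by
  funext i
  fin_cases i
  · simp [torusPhi, triplePhi, Fin.sum_univ_three]; ring
  · simp [torusPhi, triplePhi, Fin.sum_univ_three]; field_simp; ring

/-- Triples with the same elementary symmetric functions differ by a permutation. -/
theorem exists_perm_of_symm_eq {p p' : Fin 3 → K} (h1 : p 0 + p 1 + p 2 = p' 0 + p' 1 + p' 2)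
    (h2 : p 0 * p 1 + p 1 * p 2 + p 2 * p 0 = p' 0 * p' 1 + p' 1 * p' 2 + p' 2 * p' 0)
    (h3 : p 0 * p 1 * p 2 = p' 0 * p' 1 * p' 2) :
    ∃ σ : Equiv.Perm (Fin 3), ∀ i, p' i = p (σ⁻¹ i) := by
  have two : ∀ a b c d : K, a + b = c + d → a * b = c * d → (c = a ∧ d = b) ∨ (c = b ∧ d = a) := by
    intro a b c d hs hp
    have : (c - a) * (c - b) = 0 := by linear_combination hp - c * hs
    rcases mul_eq_zero.1 this with h | h
    · exact .inl ⟨by linear_combination h, by linear_combination -hs - h⟩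
    · exact .inr ⟨by linear_combination h, by linear_combination -hs - h⟩
  have hroot : (p' 0 - p 0) * ((p' 0 - p 1) * (p' 0 - p 2)) = 0 := by
    linear_combination -p' 0 ^ 2 * h1 + p' 0 * h2 - h3
  rw [exists_perm_three]
  simp only [Fin.forall_fin_succ, Fin.forall_fin_zero]
  rcases mul_eq_zero.1 hroot with h | h
  · have h0 : p' 0 = p 0 := by linear_combination h
    rcases two (p 1) (p 2) (p' 1) (p' 2) (by linear_combination h1 + h0)
      (by linear_combination h2 + (p' 1 + p' 2) * h0 - p 0 * (h1 + h0)) with ⟨a, b⟩ | ⟨a, b⟩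
    · exact .inl ⟨h0, a, b, trivial⟩
    · exact .inr (.inr (.inl ⟨h0, a, b, trivial⟩))
  rcases mul_eq_zero.1 h with h | h
  · have h0 : p' 0 = p 1 := by linear_combination h
    rcases two (p 0) (p 2) (p' 1) (p' 2) (by linear_combination h1 + h0)
      (by linear_combination h2 + (p' 1 + p' 2) * h0 - p 1 * (h1 + h0)) with ⟨a, b⟩ | ⟨a, b⟩
    · exact .inr (.inl ⟨h0, a, b, trivial⟩)
    · exact .inr (.inr (.inr (.inr (.inr ⟨h0, a, b, trivial⟩))))
  · have h0 : p' 0 = p 2 := by linear_combination h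
    rcases two (p 0) (p 1) (p' 1) (p' 2) (by linear_combination h1 + h0)
      (by linear_combination h2 + (p' 1 + p' 2) * h0 - p 2 * (h1 + h0)) with ⟨a, b⟩ | ⟨a, b⟩
    · exact .inr (.inr (.inr (.inr (.inl ⟨h0, a, b, trivial⟩))))
    · exact .inr (.inr (.inr (.inl ⟨h0, a, b, trivial⟩)))

/-- Let A be the sum and B the sum of inverses. The values A + B and AB − 3 determine A and B up to
exchange, which is inversion of the triple. As the product is 1, B is the second elementary
symmetric function, so A and B fix the triple up to order. -/
theorem exists_weyl_of_triplePhi_eq {p p' : Fin 3 → K} (hp : p 0 * p 1 * p 2 = 1)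
    (hp' : p' 0 * p' 1 * p' 2 = 1) (h : triplePhi p = triplePhi p') :
    ∃ w : Equiv.Perm (Fin 3) × ℤˣ, ∀ i, p' i = p (w.1⁻¹ i) ^ (w.2 : ℤ) := by
  have hinv : ∀ r : Fin 3 → K, r 0 * r 1 * r 2 = 1 →
      ∑ i, (r i)⁻¹ = r 0 * r 1 + r 1 * r 2 + r 2 * r 0 := by
    intro r hr
    have h0 : (r 0)⁻¹ = r 1 * r 2 := inv_eq_of_mul_eq_one_right (by linear_combination hr)
    have h1 : (r 1)⁻¹ = r 2 * r 0 := inv_eq_of_mul_eq_one_right (by linear_combination hr)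
    have h2 : (r 2)⁻¹ = r 0 * r 1 := inv_eq_of_mul_eq_one_right (by linear_combination hr)
    rw [Fin.sum_univ_three, h0, h1, h2]
    ring
  have e0 := congrFun h 0
  have e1 := congrFun h 1
  simp only [triplePhi, Matrix.cons_val_zero, Matrix.cons_val_one, Matrix.cons_val_fin_one] at e0 e1
  have hfac : (∑ i, p' i - ∑ i, p i) * (∑ i, p' i - ∑ i, (p i)⁻¹) = 0 := by
    linear_combination (-∑ i, p' i) * e0 + e1
  rcases mul_eq_zero.1 hfac with hs | hs
  · have hs' : ∑ i, (p i)⁻¹ = ∑ i, (p' i)⁻¹ := by linear_combination e0 + hs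
    rw [hinv p hp, hinv p' hp'] at hs'
    rw [Fin.sum_univ_three, Fin.sum_univ_three] at hs
    obtain ⟨σ, hσ⟩ := exists_perm_of_symm_eq (p := p) (p' := p') (by linear_combination -hs) hs'
      (hp.trans hp'.symm)
    exact ⟨(σ, 1), by simpa using hσ⟩
  · have hs' : ∑ i, p i = ∑ i, (p' i)⁻¹ := by linear_combination e0 + hs
    have hq : (p 0)⁻¹ * (p 1)⁻¹ * (p 2)⁻¹ = 1 := by
      rw [← mul_inv, ← mul_inv, hp, inv_one]
    have hq' := hinv (fun i => (p i)⁻¹) hq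
    simp only [inv_inv] at hq'
    rw [hq', hinv p' hp'] at hs'
    rw [Fin.sum_univ_three, Fin.sum_univ_three] at hs
    obtain ⟨σ, hσ⟩ := exists_perm_of_symm_eq (p := fun i => (p i)⁻¹) (p' := p')
      (by linear_combination -hs) hs' (hq.trans hp'.symm)
    exact ⟨(σ, -1), by simpa using hσ⟩

/-- Choose A with A(x − A) = y + 3; the roots of T³ − A T² + (x − A) T − 1 are then the required
torus coordinates. -/
theorem exists_torusPhi_eq [IsAlgClosed K] (X : Fin 2 → K) :
    ∃ u v : K, u ≠ 0 ∧ v ≠ 0 ∧ X = torusPhi u v := by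
  have quad : ∀ b c : K, ∃ r, r ^ 2 + b * r + c = 0 := by
    intro b c
    obtain ⟨r, hr⟩ := IsAlgClosed.exists_root
      (Polynomial.X ^ 2 + (Polynomial.C b * Polynomial.X + Polynomial.C c)) (by
        have : (Polynomial.X ^ 2 + (Polynomial.C b * Polynomial.X + Polynomial.C c)).degree = 2 := by
          compute_degree!
        rw [this]; norm_num)
    refine ⟨r, ?_⟩
    simp [Polynomial.IsRoot] at hr
    linear_combination hr
  obtain ⟨x, y, rfl⟩ : ∃ x y, X = ![x, y] :=
    ⟨X 0, X 1, by funext i; fin_cases i <;> rfl⟩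
  obtain ⟨A, hA⟩ := quad (-x) (y + 3)
  obtain ⟨u, hu⟩ : ∃ u : K, u ^ 3 - A * u ^ 2 + (x - A) * u - 1 = 0 := by
    let p : Polynomial K := Polynomial.X ^ 3 + (Polynomial.C (-A) * Polynomial.X ^ 2
      + Polynomial.C (x - A) * Polynomial.X + Polynomial.C (-1))
    have hp : p.degree = 3 := by
      simp only [p]; compute_degree!
    obtain ⟨u, hu⟩ := IsAlgClosed.exists_root p (by rw [hp]; norm_num)
    refine ⟨u, ?_⟩
    simp [p, Polynomial.IsRoot] at hu
    linear_combination hu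
  have hu0 : u ≠ 0 := by rintro rfl; simp at hu
  obtain ⟨v, hv⟩ := quad (-(A - u)) u⁻¹
  have hv0 : v ≠ 0 := by rintro rfl; simp [hu0] at hv
  refine ⟨u, v, hu0, hv0, ?_⟩
  have hA' : A = u + v + u⁻¹ * v⁻¹ := by
    field_simp at hv ⊢
    linear_combination -hv
  have hx : x = A + (u⁻¹ + v⁻¹ + u * v) := by
    rw [hA'] at hu ⊢
    field_simp at hu ⊢
    linear_combination hu
  have hy : y = A * (u⁻¹ + v⁻¹ + u * v) - 3 := by
    rw [hx] at hA
    linear_combination hA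
  funext i
  fin_cases i
  · simp only [Fin.zero_eta, torusPhi, Matrix.cons_val_zero]
    rw [hx, hA']
    ring
  · simp only [Fin.mk_one, torusPhi, Matrix.cons_val_one, Matrix.cons_val_fin_one]
    rw [hy, hA']
    field_simp
    ring

end Invariants

/-! ### Frobenius and logarithms on the N-torsion of the torus -/

theorem mem_range_algebraMap_of_pow_card {F K : Type*} [Field F] [Fintype F] [Field K] [Algebra F K]
    {x : K} (hx : x ^ Fintype.card F = x) : x ∈ Set.range (algebraMap F K) := by
  classical
  have hq : 1 < Fintype.card F := Fintype.one_lt_card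
  set P : Polynomial K := Polynomial.X ^ Fintype.card F - Polynomial.X with hP
  have hP0 : P ≠ 0 := FiniteField.X_pow_card_sub_X_ne_zero K hq
  have hsub : (Finset.univ.image (algebraMap F K)) ⊆ P.roots.toFinset := by
    intro y hy
    obtain ⟨a, -, rfl⟩ := Finset.mem_image.1 hy
    rw [Multiset.mem_toFinset, Polynomial.mem_roots hP0]
    simp [hP, Polynomial.IsRoot, ← map_pow, FiniteField.pow_card]
  have hcard : P.roots.toFinset.card ≤ (Finset.univ.image (algebraMap F K)).card := by
    rw [Finset.card_image_of_injective _ (algebraMap F K).injective, Finset.card_univ]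
    refine (Multiset.toFinset_card_le _).trans ((Polynomial.card_roots' P).trans ?_)
    rw [hP, FiniteField.X_pow_card_sub_X_natDegree_eq K hq]
  have heq := Finset.eq_of_subset_of_card_le hsub hcard
  have hmem : x ∈ P.roots.toFinset := by
    rw [Multiset.mem_toFinset, Polynomial.mem_roots hP0]
    simp [hP, Polynomial.IsRoot, hx]
  rw [← heq] at hmem
  obtain ⟨a, -, ha⟩ := Finset.mem_image.1 hmem
  exact ⟨a, ha⟩

theorem exists_addChar_of_isPrimitiveRoot {K : Type*} [Field K] {N : ℕ} [NeZero N] {ζ : K}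
    (hζ : IsPrimitiveRoot ζ N) : ∃ E : AddChar (ZMod N) K, Function.Injective E ∧
      ∀ t : K, t ^ N = 1 → ∃ x, E x = t := by
  refine ⟨AddChar.zmodChar N hζ.pow_eq_one, fun x y h => ?_, fun t ht => ?_⟩
  · rw [AddChar.zmodChar_apply, AddChar.zmodChar_apply] at h
    exact ZMod.val_injective N (hζ.pow_inj x.val_lt y.val_lt h)
  · obtain ⟨i, -, hi⟩ := hζ.eq_pow_of_pow_eq_one ht
    exact ⟨(i : ZMod N), by rw [AddChar.zmodChar_apply', hi]⟩

section Exponential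

variable {K : Type*} [Field K] {N : ℕ} (E : AddChar (ZMod N) K)

theorem AddChar.apply_natCast_mul {R K : Type*} [CommRing R] [Field K] (E : AddChar R K) (n : ℕ)
    (x : R) : E (n * x) = E x ^ n := by
  rw [← nsmul_eq_mul, AddChar.map_nsmul_eq_pow]

theorem AddChar.apply_ne_zero {R K : Type*} [CommRing R] [Field K] (E : AddChar R K) (x : R) :
    E x ≠ 0 := by
  intro h
  have := AddChar.map_add_eq_mul E x (-x)
  rw [h, zero_mul, add_neg_cancel, AddChar.map_zero_eq_one] at this
  exact one_ne_zero this

theorem AddChar.apply_weyl_smul (w : Equiv.Perm (Fin 3) × ℤˣ) (s : Fin 3 → ZMod N) (i : Fin 3) :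
    E ((w • s) i) = E (s (w.1⁻¹ i)) ^ (w.2 : ℤ) := by
  rw [weyl_smul_apply]
  rcases Int.units_eq_one_or w.2 with h | h <;> rw [h]
  · simp
  · simp [AddChar.map_neg_eq_inv]

/-- The orbit sums at the torus point with logarithms `s`. -/
def logPhi (s : Fin 3 → ZMod N) : Fin 2 → K := triplePhi fun i => E (s i)

theorem logPhi_weyl_smul (w : Equiv.Perm (Fin 3) × ℤˣ) (s : Fin 3 → ZMod N) :
    logPhi E (w • s) = logPhi E s := by
  simp only [logPhi, AddChar.apply_weyl_smul]
  rcases Int.units_eq_one_or w.2 with h | h <;> rw [h]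
  · simpa using triplePhi_perm (fun i => E (s i)) w.1⁻¹
  · simpa using (triplePhi_inv fun i => E (s (w.1⁻¹ i))).trans
      (triplePhi_perm (fun i => E (s i)) w.1⁻¹)

theorem apply_mul_eq_one {s : Fin 3 → ZMod N} (h : s 0 + s 1 + s 2 = 0) :
    E (s 0) * E (s 1) * E (s 2) = 1 := by
  rw [← AddChar.map_add_eq_mul, ← AddChar.map_add_eq_mul, h, AddChar.map_zero_eq_one]

theorem exists_weyl_smul_of_logPhi_eq (hE : Function.Injective E) {s t : Fin 3 → ZMod N}
    (hs : s 0 + s 1 + s 2 = 0) (ht : t 0 + t 1 + t 2 = 0) (h : logPhi E s = logPhi E t) :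
    ∃ w : Equiv.Perm (Fin 3) × ℤˣ, t = w • s := by
  obtain ⟨w, hw⟩ := exists_weyl_of_triplePhi_eq (apply_mul_eq_one E hs) (apply_mul_eq_one E ht) h
  refine ⟨w, funext fun i => hE ?_⟩
  rw [AddChar.apply_weyl_smul]
  exact hw i

theorem logPhi_eq_torusPhi {s : Fin 3 → ZMod N} (h : s 0 + s 1 + s 2 = 0) :
    logPhi E s = torusPhi (E (s 0)) (E (s 1)) := by
  rw [torusPhi_eq_triplePhi (E.apply_ne_zero _) (E.apply_ne_zero _), logPhi]
  congr 1
  funext i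
  fin_cases i
  · rfl
  · rfl
  · have := apply_mul_eq_one E h
    change E (s 2) = (E (s 0))⁻¹ * (E (s 1))⁻¹
    rw [← mul_inv]
    exact eq_inv_of_mul_eq_one_right this

theorem aeval_logPhi_g2Folding {s : Fin 3 → ZMod N} (h : s 0 + s 1 + s 2 = 0) (k : ℕ) (i : Fin 2) :
    aeval (logPhi E s) (g2Folding k i) = logPhi E (fun i => (k : ZMod N) * s i) i := by
  rw [g2Folding_eq_g2Explicit, logPhi_eq_torusPhi E h, aeval_torusPhi_g2Explicit
    (E.apply_ne_zero _) (E.apply_ne_zero _), logPhi_eq_torusPhi E (by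
      linear_combination (k : ZMod N) * h), E.apply_natCast_mul, E.apply_natCast_mul]

theorem map_logPhi (f : K →+* K) {q : ℕ} (hf : ∀ x, f x = x ^ q) (s : Fin 3 → ZMod N) (i : Fin 2) :
    f (logPhi E s i) = logPhi E (fun i => (q : ZMod N) * s i) i := by
  fin_cases i <;>
  simp [logPhi, triplePhi, E.apply_natCast_mul, ← hf, map_ofNat f 3]

end Exponential

/-! ### The value set as an image of torsion triples -/

theorem map_triplePhi {K : Type*} [Field K] (f : K →+* K) (p : Fin 3 → K) (i : Fin 2) :
    f (triplePhi p i) = triplePhi (fun i => f (p i)) i := by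
  fin_cases i <;> simp [triplePhi, map_ofNat f 3]

/-- Six iterations of the q-power map act as w⁶, which is trivial in S₃ × {±1}. -/
theorem pow_sub_one_eq_one_of_weyl {K : Type*} [Field K] {p : Fin 3 → K} (hp : ∀ i, p i ≠ 0)
    {q : ℕ} (hq : 0 < q) (w : Equiv.Perm (Fin 3) × ℤˣ)
    (hw : ∀ i, p i ^ q = p (w.1⁻¹ i) ^ (w.2 : ℤ)) (i : Fin 3) : p i ^ (q ^ 6 - 1) = 1 := by
  have key : ∀ n i, p i ^ q ^ n = p ((w.1⁻¹ ^ n) i) ^ ((w.2 ^ n : ℤˣ) : ℤ) := by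
    intro n
    induction n with
    | zero => intro i; simp
    | succ n ih =>
      intro i
      rw [pow_succ, pow_mul, ih, ← zpow_natCast, ← zpow_mul, mul_comm, zpow_mul, zpow_natCast, hw,
        ← zpow_mul, pow_succ', pow_succ']
      simp
  have h6 : ∀ σ : Equiv.Perm (Fin 3), σ ^ 6 = 1 := fun σ => by
    simpa [Fintype.card_perm, Nat.factorial] using pow_card_eq_one (x := σ)
  have h6' : w.2 ^ 6 = 1 := by
    rcases Int.units_eq_one_or w.2 with h | h <;> rw [h] <;> decide
  have := key 6 i
  rw [h6, h6'] at this
  have hpos : 0 < q ^ 6 := Nat.pow_pos hq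
  rw [← Nat.sub_add_cancel hpos, pow_succ] at this
  simpa [hp i] using this

/-- Frobenius fixes the coordinates of v, so a torus point above v and its q-th power have the same
invariants and differ by some w. -/
theorem exists_logPhi_eq {F K : Type*} [Field F] [Fintype F] [Field K] [Algebra F K] [IsAlgClosed K]
    {N : ℕ} (hN : N = Fintype.card F ^ 6 - 1) (E : AddChar (ZMod N) K)
    (hE : Function.Injective E) (hE' : ∀ t : K, t ^ N = 1 → ∃ x, E x = t) (v : Fin 2 → F) :
    ∃ s : Fin 3 → ZMod N, s 0 + s 1 + s 2 = 0 ∧ (∃ w : Equiv.Perm (Fin 3) × ℤˣ,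
      (fun i => ((Fintype.card F : ℕ) : ZMod N) * s i) = w • s) ∧
      logPhi E s = fun i => algebraMap F K (v i) := by
  obtain ⟨a, b, ha, hb, hab⟩ := exists_torusPhi_eq (fun i => algebraMap F K (v i))
  rw [torusPhi_eq_triplePhi ha hb] at hab
  set p : Fin 3 → K := ![a, b, a⁻¹ * b⁻¹] with hp
  have hp1 : p 0 * p 1 * p 2 = 1 := by simp [hp]; field_simp
  have hp0 : ∀ i, p i ≠ 0 := by
    intro i
    fin_cases i
    · exact ha
    · exact hb
    · exact mul_ne_zero (inv_ne_zero ha) (inv_ne_zero hb)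
  have hfrob : triplePhi p = triplePhi fun i => p i ^ Fintype.card F := by
    funext i
    have h := map_triplePhi (FiniteField.frobeniusAlgHom F K : K →+* K) p i
    rw [← hab] at h
    simp only [RingHom.coe_coe, AlgHom.commutes] at h
    exact (congrFun hab i).symm.trans h
  obtain ⟨w, hw⟩ := exists_weyl_of_triplePhi_eq hp1 (by
    rw [← mul_pow, ← mul_pow, hp1, one_pow]) hfrob
  have hroot := pow_sub_one_eq_one_of_weyl hp0 Fintype.card_pos w hw
  rw [← hN] at hroot
  choose s hs using fun i => hE' (p i) (hroot i)
  refine ⟨s, hE ?_, ⟨w, funext fun i => hE ?_⟩, ?_⟩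
  · rw [AddChar.map_add_eq_mul, AddChar.map_add_eq_mul, hs, hs, hs, hp1, AddChar.map_zero_eq_one]
  · rw [E.apply_natCast_mul, AddChar.apply_weyl_smul, hs, hs, hw]
  · rw [hab, logPhi]
    simp only [hs]

theorem image_range_inducedMap {F K : Type*} [Field F] [Fintype F] [Field K] [Algebra F K]
    [IsAlgClosed K] {N : ℕ} (hN : N = Fintype.card F ^ 6 - 1) (E : AddChar (ZMod N) K)
    (hE : Function.Injective E) (hE' : ∀ t : K, t ^ N = 1 → ∃ x, E x = t) (k : ℕ) :
    (fun (v : Fin 2 → F) i => algebraMap F K (v i)) '' Set.range (inducedMap F (g2Folding k)) =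
      logPhi E '' multipleSet N (Fintype.card F) k := by
  have hmap : ∀ (v : Fin 2 → F) (s : Fin 3 → ZMod N), s 0 + s 1 + s 2 = 0 →
      logPhi E s = (fun i => algebraMap F K (v i)) →
      (fun i => algebraMap F K (inducedMap F (g2Folding k) v i)) =
        logPhi E fun i => (k : ZMod N) * s i := by
    intro v s h0 hs
    funext i
    rw [← aeval_logPhi_g2Folding E h0, hs, inducedMap]
    exact (aeval_algebraMap_apply K v (g2Folding k i)).symm
  ext y
  constructor
  · rintro ⟨_, ⟨v, rfl⟩, rfl⟩
    obtain ⟨s, h0, hw, hs⟩ := exists_logPhi_eq hN E hE hE' v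
    exact ⟨_, ⟨s, h0, hw, rfl⟩, (hmap v s h0 hs).symm⟩
  · rintro ⟨_, ⟨s, h0, ⟨w, hw⟩, rfl⟩, rfl⟩
    -- Conversely, if q s = w s then Frobenius fixes Φ at s, because Φ is W-invariant.
    have hfix : ∀ i, logPhi E s i ∈ Set.range (algebraMap F K) := by
      intro i
      refine mem_range_algebraMap_of_pow_card ?_
      have := map_logPhi E (FiniteField.frobeniusAlgHom F K : K →+* K) (q := Fintype.card F)
        (fun _ => rfl) s i
      rw [hw, logPhi_weyl_smul] at this
      exact this
    choose v hv using hfix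
    exact ⟨_, ⟨v, rfl⟩, hmap v s h0 (funext fun i => (hv i).symm)⟩

theorem ncard_range_inducedMap {F : Type*} [Field F] [Fintype F] (k : ℕ) :
    ∃ N : ℕ, NeZero N ∧ (N : ℤ) = ((Fintype.card F : ℕ) : ℤ) ^ 6 - 1 ∧
      12 * (Set.range (inducedMap F (g2Folding k))).ncard =
        ∑ w : Equiv.Perm (Fin 3) × ℤˣ, {s : Fin 3 → ZMod N |
          (fun i => ((Fintype.card F : ℕ) : ZMod N) * s i) = w • s ∧
            s ∈ multipleSet N (Fintype.card F) k}.ncard := by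
  set q := Fintype.card F with hq
  have hq2 : 2 ≤ q := Fintype.one_lt_card
  have hpow : 2 ^ 6 ≤ q ^ 6 := Nat.pow_le_pow_left hq2 6
  obtain ⟨N, hN⟩ : ∃ N, N = q ^ 6 - 1 := ⟨_, rfl⟩
  have hN0 : NeZero N := ⟨by omega⟩
  have hNZ : (N : ℤ) = (q : ℤ) ^ 6 - 1 := by
    rw [hN, Nat.cast_sub (by omega)]; push_cast; rfl
  refine ⟨N, hN0, hNZ, ?_⟩
  let K := AlgebraicClosure F
  -- N is −1 in K, so primitive N-th roots of unity exist.
  have hNK : NeZero (N : K) := by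
    constructor
    rw [hN, Nat.cast_sub (by omega)]
    have : (q : K) = 0 := by
      have h : (q : F) = 0 := FiniteField.cast_card_eq_zero F
      have := congrArg (algebraMap F K) h
      simpa using this
    push_cast
    rw [this]
    simp
  obtain ⟨ζ, hζ⟩ := HasEnoughRootsOfUnity.exists_primitiveRoot K N
  obtain ⟨E, hE, hE'⟩ := exists_addChar_of_isPrimitiveRoot hζ
  have himage := image_range_inducedMap (F := F) (K := K) hN E hE hE' k
  have hinj : Function.Injective fun (v : Fin 2 → F) i => algebraMap F K (v i) := by
    intro v v' h
    funext i
    exact (algebraMap F K).injective (congrFun h i)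
  rw [← Set.ncard_image_of_injective _ hinj, himage]
  have hcard : Fintype.card (Equiv.Perm (Fin 3) × ℤˣ) = 12 := by decide
  have hsum : ∀ s ∈ multipleSet N q k, s 0 + s 1 + s 2 = 0 := by
    rintro _ ⟨s, h0, -, rfl⟩
    linear_combination (k : ZMod N) * h0
  rw [← hcard]
  refine card_mul_ncard_image (multipleSet N q k) (fun s i => (q : ZMod N) * s i) (logPhi E)
    ?_ ?_ (fun w s _ => logPhi_weyl_smul E w s)
    (fun s hs t ht h => exists_weyl_smul_of_logPhi_eq E hE (hsum s hs) (hsum t ht) h)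
  -- Applying g conjugates the Weyl element: q(g s) = (g w g⁻¹)(g s).
  · rintro g _ ⟨s, h0, ⟨w, hw⟩, rfl⟩
    refine ⟨g • s, weyl_smul_sum_eq_zero g h0, ⟨g * w * g⁻¹, ?_⟩, weyl_smul_mul g _ s⟩
    rw [← weyl_smul_mul, hw, mul_smul, mul_smul, inv_smul_smul]
  · rintro _ ⟨s, h0, ⟨w, hw⟩, rfl⟩
    refine ⟨w, ?_⟩
    rw [weyl_smul_mul, ← hw]
    funext i
    ring

theorem theorem3 (k : ℕ) (hk : 0 < k) (F : Type*) [Field F] [Finite F] (q : ℕ)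
    (hq : Nat.card F = q) :
    ((Set.range (inducedMap F (g2Folding k))).ncard : ℚ) =
        (divGcd (q - 1) k : ℚ) ^ 2 / 12 + (divGcd (q + 1) k : ℚ) ^ 2 / 12
        + (divGcd (q ^ 2 - 1) k : ℚ) / 2 + (divGcd (q ^ 2 + q + 1) k : ℚ) / 6
        + (divGcd (q ^ 2 - q + 1) k : ℚ) / 6 + g2Eta k q ∧
      (Nat.gcd k 6 = 1 → g2Eta k q = 0) := by
  refine ⟨?_, g2Eta_eq_zero⟩
  have := Fintype.ofFinite F
  rw [Nat.card_eq_fintype_card] at hq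
  subst hq
  have hq2 : 2 ≤ Fintype.card F := Fintype.one_lt_card
  obtain ⟨N, hN0, hN, h⟩ := ncard_range_inducedMap (F := F) k
  refine formula_of_twelve_mul hq2 ?_
  rw [h]
  exact sum_ncard_weyl hq2 hN
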